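/- A $k$-cycle $(x_0,x_1,\dots,x_{k-1})$, with $k\ge 3$ and pairwise distinct $x_i$, is the graph with vertices $x_0,\dots,x_{k-1}$ and edges $\{x_0,x_1\},\{x_1,x_2\},\dots,\{x_{k-1},x_0\}$. A $k$-cycle system of order $n$ is a set of $k$-cycles whose edges partition the edge set of the complete graph $K_n$ on $n$ vertices. Two $k$-cycle systems $\mathcal C,\mathcal C'$ on the same $n$ vertices are orthogonal if every cycle of $\mathcal C$ has at most one edge in common with every cycle of $\mathcal C'$. Let $\mu(k,n)$ be the maximum number of mutually (i.e. pairwise) orthogonal $k$-cycle systems of order $n$. Then: (i) $\mu(k,n)\ge k$ for $(k,n)\in\{(5,71),(7,211),(11,419),(13,599)\}$; (ii) $\mu(5,151)\ge 10$; (iii) $\mu(3n,18n^2+1)\ge 4$ for $n\in\{3,7,9\}$; (iv) $\mu(11,243)\ge 9$; (v) $\mu(k,2kw+1)\ge \left\lceil \dfrac{w}{4k^4}\right\rceil$ for all integers $k\ge 3$ and $w\geq 1$ such that $kw$ is odd and $2kw+1$ is a prime power. -/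

import Mathlib

/-- `C` is the `k`-cycle `(x_0, x_1, …, x_{k-1})` for some pairwise distinct vertices `x_i`: its
vertices are the `x_i` and its edges are `{x_0, x_1}, {x_1, x_2}, …, {x_{k-1}, x_0}`.
A cycle has length at least three. Indices are read modulo `k`. -/
def IsKCycle {V : Type*} (k : ℕ) (C : (⊤ : SimpleGraph V).Subgraph) : Prop :=
  3 ≤ k ∧ ∃ x : ZMod k → V, Function.Injective x ∧ C.verts = Set.range x ∧
    C.edgeSet = Set.range (fun i : ZMod k => s(x i, x (i + 1)))

/-- A `k`-cycle system on the vertex set `V`: a set of `k`-cycles whose edges partition the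
edge set of the complete graph on `V`. -/
structure IsCycleSystem {V : Type*} (k : ℕ) (𝒞 : Set (⊤ : SimpleGraph V).Subgraph) : Prop where
  isKCycle : ∀ C ∈ 𝒞, IsKCycle k C
  partition : ∀ e ∈ (⊤ : SimpleGraph V).edgeSet, ∃! C, C ∈ 𝒞 ∧ e ∈ C.edgeSet

/-- Two graph decompositions are orthogonal if any graph of the first one has at most one edge in
common with any graph of the second one. -/
def OrthogonalDecompositions {V : Type*} (𝒞 𝒟 : Set (⊤ : SimpleGraph V).Subgraph) : Prop :=
  ∀ C ∈ 𝒞, ∀ D ∈ 𝒟, (C.edgeSet ∩ D.edgeSet).Subsingleton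

/-- A set of mutually orthogonal `k`-cycle systems on the vertex set `V`. -/
structure IsMutuallyOrthogonalCycleSystems {V : Type*} (k : ℕ)
    (𝓕 : Set (Set (⊤ : SimpleGraph V).Subgraph)) : Prop where
  isCycleSystem : ∀ 𝒞 ∈ 𝓕, IsCycleSystem k 𝒞
  orthogonal : 𝓕.Pairwise OrthogonalDecompositions

/-- The numbers `r` for which there are `r` mutually orthogonal `k`-cycle systems of order `n`. -/
def orthogonalCycleSystemNumbers (k n : ℕ) : Set ℕ :=
  {r | ∃ 𝓕 : Set (Set (⊤ : SimpleGraph (Fin n)).Subgraph),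
    IsMutuallyOrthogonalCycleSystems k 𝓕 ∧ 𝓕.ncard = r}

/-- The maximum number `μ(k, n)` of mutually orthogonal `k`-cycle systems of order `n`. -/
noncomputable def maxOrthogonalCycleSystems (k n : ℕ) : ℕ :=
  sSup (orthogonalCycleSystemNumbers k n)

/-- The supremum defining `μ(k, n)` is a true maximum. -/
theorem isGreatest_maxOrthogonalCycleSystems (k n : ℕ) :
    IsGreatest (orthogonalCycleSystemNumbers k n) (maxOrthogonalCycleSystems k n) := by
  have hne : (orthogonalCycleSystemNumbers k n).Nonempty :=
    ⟨0, ∅, ⟨by simp, by simp⟩, by simp⟩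
  have hbd : BddAbove (orthogonalCycleSystemNumbers k n) := by
    refine ⟨Nat.card (Set (⊤ : SimpleGraph (Fin n)).Subgraph), ?_⟩
    rintro r ⟨𝓕, -, rfl⟩
    exact Set.ncard_le_card 𝓕
  exact ⟨Nat.sSup_mem hne hbd, fun r hr => le_csSup hbd hr⟩

/-! Label the vertices by an abelian group in which only 0 equals its own negative. A zero-sum
sequence with distinct partial sums traces a cycle. If the terms of a family of such sequences meet
each pair {d, -d}, d ≠ 0, exactly once, all translates of their cycles form a cycle system
(`IsStarter.isCycleSystem`). Two such systems are orthogonal once no sequence of one shares terms,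
up to sign, in two positions with a sequence of the other (`orthogonalDecompositions_development`).

Take the additive group of a field of order 2kw + 1 with w odd. The 2w-th roots of unity are ± the
w-th roots and have k cosets, so a zero-sum sequence of coset representatives with distinct partial
sums, multiplied by all w-th roots of unity, is a starter (`IsTransversal.isStarter`). Orthogonality
becomes a condition on ratios of entries up to sign (`RatioDisjoint`). For odd k, progressions in a
primitive k-th root of unity give another starter, orthogonal to all of these when w = k.

For (i) and (ii), one or two explicit sequences have all their ratios distinct up to sign; their
multiples by k coset representatives are mutually orthogonal. For (iii) and (iv), three or eight
explicit sequences are joined by the progressions, as w = k. For (v), the progressions suffice when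
the ceiling is at most 1. Otherwise sequences are built greedily, each avoiding the ratios of its
predecessors; the last two entries have a prescribed sum, and `card_add_eq_ge` provides enough
choices for them by an incidence bound. -/

open Finset

/-! ### Cycle systems as translates of zero-sum sequences. -/

section Development

variable {V G : Type*} [AddCommGroup G]

/-- The `n`-th partial sum of the sequence `a`. -/
def partialSum (a : ℕ → G) (n : ℕ) : G := ∑ i ∈ range n, a i

theorem partialSum_succ (a : ℕ → G) (n : ℕ) : partialSum a (n + 1) = partialSum a n + a n :=
  Finset.sum_range_succ a n

/-- The first `k` terms of `a` sum to zero and have pairwise distinct proper partial sums. -/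
structure IsSimpleZeroSum (k : ℕ) (a : ℕ → G) : Prop where
  three_le : 3 ≤ k
  sum_eq_zero : partialSum a k = 0
  injOn : ∀ i < k, ∀ j < k, partialSum a i = partialSum a j → i = j

/-- The `k`-cycle whose vertices are the partial sums of `a`, translated by `g`. -/
def developedCycle (e : G ≃ V) (k : ℕ) (a : ℕ → G) (g : G) : (⊤ : SimpleGraph V).Subgraph where
  verts := Set.range fun i : ZMod k => e (g + partialSum a i.val)
  Adj u v := u ≠ v ∧ ∃ i : ZMod k,
    s(u, v) = s(e (g + partialSum a i.val), e (g + partialSum a (i + 1).val))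
  adj_sub h := h.1
  edge_vert := by
    rintro u v ⟨-, i, hi⟩
    rcases Sym2.eq_iff.1 hi with h | h
    · exact ⟨i, h.1.symm⟩
    · exact ⟨i + 1, h.1.symm⟩
  symm := ⟨fun u v ⟨h, i, hi⟩ => ⟨h.symm, i, by rw [Sym2.eq_swap, hi]⟩⟩

/-- This closes the cycle: at the last index the left side wraps to the empty sum and the right side
is the full sum, both zero. -/
theorem IsSimpleZeroSum.partialSum_val_add_one {k : ℕ} {a : ℕ → G} (ha : IsSimpleZeroSum k a)
    (i : ZMod k) : partialSum a (i + 1).val = partialSum a (i.val + 1) := by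
  have h3 := ha.three_le
  have : NeZero k := ⟨by omega⟩
  have : Fact (1 < k) := ⟨by omega⟩
  rcases Nat.lt_or_ge (i.val + 1) k with h | h
  · rw [ZMod.val_add_of_lt (by rw [ZMod.val_one]; exact h), ZMod.val_one]
  · have hi : i.val + 1 = k := le_antisymm (ZMod.val_lt i) h
    have : (i + 1).val = 0 := by
      rw [ZMod.val_add, ZMod.val_one, hi, Nat.mod_self]
    rw [this, hi, ha.sum_eq_zero]
    simp [partialSum]

theorem IsSimpleZeroSum.ne_zero {k : ℕ} {a : ℕ → G} (ha : IsSimpleZeroSum k a) {i : ℕ}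
    (hi : i < k) : a i ≠ 0 := by
  intro h
  have h3 := ha.three_le
  have h1 : partialSum a (i + 1) = partialSum a i := by rw [partialSum_succ, h, add_zero]
  rcases Nat.lt_or_ge (i + 1) k with hlt | hge
  · have := ha.injOn _ hlt _ hi h1; omega
  · have hk : i + 1 = k := by omega
    rw [hk, ha.sum_eq_zero] at h1
    have := ha.injOn 0 (by omega) i hi (by rw [← h1]; simp [partialSum])
    omega

theorem IsSimpleZeroSum.mem_edgeSet {e : G ≃ V} {k : ℕ} {a : ℕ → G}
    (ha : IsSimpleZeroSum k a) (g : G) (x : Sym2 V) :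
    x ∈ (developedCycle e k a g).edgeSet ↔
      ∃ i < k, x = s(e (g + partialSum a i), e (g + partialSum a i + a i)) := by
  have h3 := ha.three_le
  have : NeZero k := ⟨by omega⟩
  induction x using Sym2.ind with | _ u v
  rw [SimpleGraph.Subgraph.mem_edgeSet]
  constructor
  · rintro ⟨-, i, hi⟩
    exact ⟨i.val, ZMod.val_lt i, by
      rw [hi, ha.partialSum_val_add_one, partialSum_succ, add_assoc]⟩
  · rintro ⟨i, hik, hi⟩
    refine ⟨?_, (i : ZMod k), ?_⟩
    · rintro rfl
      have hne := ha.ne_zero hik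
      rcases Sym2.eq_iff.1 hi with h | h
      · exact hne (left_eq_add.1 (e.injective (h.1.symm.trans h.2)))
      · exact hne (left_eq_add.1 (e.injective (h.2.symm.trans h.1)))
    · rw [hi, ha.partialSum_val_add_one, ZMod.val_cast_of_lt hik, partialSum_succ, add_assoc]

theorem IsSimpleZeroSum.isKCycle {k : ℕ} {a : ℕ → G} (ha : IsSimpleZeroSum k a) (e : G ≃ V)
    (g : G) : IsKCycle k (developedCycle e k a g) := by
  have h3 := ha.three_le
  have : NeZero k := ⟨by omega⟩
  refine ⟨h3, fun i => e (g + partialSum a i.val), ?_, rfl, ?_⟩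
  · intro i j hij
    exact ZMod.val_injective k
      (ha.injOn _ (ZMod.val_lt i) _ (ZMod.val_lt j) (add_left_cancel (e.injective hij)))
  · ext x
    rw [ha.mem_edgeSet]
    constructor
    · rintro ⟨i, hik, rfl⟩
      refine ⟨(i : ZMod k), ?_⟩
      simp only [ha.partialSum_val_add_one, ZMod.val_cast_of_lt hik, partialSum_succ, add_assoc]
    · rintro ⟨i, rfl⟩
      refine ⟨i.val, ZMod.val_lt i, ?_⟩
      simp only [ha.partialSum_val_add_one, partialSum_succ, add_assoc]

/-- A set of simple zero-sum sequences such that every non-zero group element is, up to sign, a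
term of exactly one of them, in exactly one position. -/
structure IsStarter (k : ℕ) (T : Set (ℕ → G)) : Prop where
  simple : ∀ a ∈ T, IsSimpleZeroSum k a
  cover : ∀ d : G, d ≠ 0 → ∃ a ∈ T, ∃ i < k, a i = d ∨ a i = -d
  unique : ∀ a ∈ T, ∀ b ∈ T, ∀ i < k, ∀ j < k, (a i = b j ∨ a i = -b j) → a = b ∧ i = j

/-- All translates of the cycles given by the sequences in `T`. -/
def development (e : G ≃ V) (k : ℕ) (T : Set (ℕ → G)) : Set (⊤ : SimpleGraph V).Subgraph :=
  {C | ∃ a ∈ T, ∃ g : G, C = developedCycle e k a g}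

theorem eq_or_neg_of_edge_eq {e : G ≃ V} {g h c d : G}
    (hx : s(e g, e (g + c)) = s(e h, e (h + d))) : c = d ∧ g = h ∨ c = -d ∧ g = h + d := by
  rcases Sym2.eq_iff.1 hx with ⟨h1, h2⟩ | ⟨h1, h2⟩
  · have h1 := e.injective h1
    have h2 := e.injective h2
    subst h1
    exact Or.inl ⟨add_left_cancel h2, rfl⟩
  · have h1 := e.injective h1
    have h2 := e.injective h2
    subst h1
    exact Or.inr ⟨eq_neg_of_add_eq_zero_right (by
      rw [add_assoc] at h2; exact add_left_cancel (h2.trans (add_zero h).symm)), rfl⟩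

/-- The difference of the endpoints determines the sequence and the position; the endpoints then
determine the translate. -/
theorem IsStarter.isCycleSystem {k : ℕ} {T : Set (ℕ → G)} (hT : IsStarter k T) (e : G ≃ V)
    (htwo : ∀ d : G, d = -d → d = 0) : IsCycleSystem k (development e k T) := by
  refine ⟨?_, ?_⟩
  · rintro C ⟨a, ha, g, rfl⟩
    exact (hT.simple a ha).isKCycle e g
  · intro x hx
    induction x using Sym2.ind with | _ u v
    obtain ⟨u, rfl⟩ := e.surjective u
    obtain ⟨v, rfl⟩ := e.surjective v
    have huv : u ≠ v := by
      rintro rfl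
      exact hx rfl
    obtain ⟨a, haT, i, hik, hi⟩ := hT.cover (v - u) (sub_ne_zero.2 huv.symm)
    have hex : ∃ g : G, s(e u, e v) ∈ (developedCycle e k a g).edgeSet := by
      simp only [(hT.simple a haT).mem_edgeSet]
      rcases hi with hi | hi
      · exact ⟨u - partialSum a i, i, hik, by rw [hi]; simp⟩
      · exact ⟨v - partialSum a i, i, hik, by rw [hi, Sym2.eq_swap]; simp⟩
    obtain ⟨g, hg⟩ := hex
    refine ⟨_, ⟨⟨a, haT, g, rfl⟩, hg⟩, ?_⟩
    rintro C ⟨⟨b, hbT, h, rfl⟩, hb⟩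
    rw [(hT.simple a haT).mem_edgeSet] at hg
    rw [(hT.simple b hbT).mem_edgeSet] at hb
    obtain ⟨i, hik, hi⟩ := hg
    obtain ⟨j, hjk, hj⟩ := hb
    rcases eq_or_neg_of_edge_eq (hj.symm.trans hi) with ⟨h1, h2⟩ | ⟨h1, h2⟩
    · obtain ⟨rfl, rfl⟩ := hT.unique b hbT a haT j hjk i hik (Or.inl h1)
      rw [add_right_cancel h2]
    · obtain ⟨rfl, rfl⟩ := hT.unique b hbT a haT j hjk i hik (Or.inr h1)
      -- Traversing the edge in opposite directions would make a term equal to its own negative.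
      exact absurd (htwo _ h1) ((hT.simple b hbT).ne_zero hjk)

/-- Within one translate an edge is determined by its position, so it is enough to show that the
positions of two common edges agree. -/
theorem orthogonalDecompositions_development {k : ℕ} {T U : Set (ℕ → G)} (hT : IsStarter k T)
    (hU : IsStarter k U) (e : G ≃ V)
    (h : ∀ a ∈ T, ∀ b ∈ U, ∀ i < k, ∀ j < k, ∀ i' < k, ∀ j' < k,
      (a i = b i' ∨ a i = -b i') → (a j = b j' ∨ a j = -b j') → i = j) :
    OrthogonalDecompositions (development e k T) (development e k U) := by
  rintro C ⟨a, ha, g, rfl⟩ D ⟨b, hb, g', rfl⟩ x ⟨hx, hx'⟩ y ⟨hy, hy'⟩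
  rw [(hT.simple a ha).mem_edgeSet] at hx hy
  rw [(hU.simple b hb).mem_edgeSet] at hx' hy'
  obtain ⟨i, hi, rfl⟩ := hx
  obtain ⟨j, hj, rfl⟩ := hy
  obtain ⟨i', hi', h1⟩ := hx'
  obtain ⟨j', hj', h2⟩ := hy'
  have key := h a ha b hb i hi j hj i' hi' j' hj'
    ((eq_or_neg_of_edge_eq h1).imp And.left And.left)
    ((eq_or_neg_of_edge_eq h2).imp And.left And.left)
  rw [key]

theorem IsSimpleZeroSum.not_subsingleton_edgeSet {k : ℕ} {a : ℕ → G} (ha : IsSimpleZeroSum k a)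
    (e : G ≃ V) (g : G) : ¬ (developedCycle e k a g).edgeSet.Subsingleton := by
  intro hs
  have h3 := ha.three_le
  have key := hs ((ha.mem_edgeSet g _).2 ⟨0, by omega, rfl⟩)
    ((ha.mem_edgeSet g _).2 ⟨1, by omega, rfl⟩)
  have e1 : g + partialSum a 0 + a 0 = g + partialSum a 1 := by
    rw [add_assoc, ← partialSum_succ]
  have e2 : g + partialSum a 1 + a 1 = g + partialSum a 2 := by
    rw [add_assoc, ← partialSum_succ]
  rw [e1, e2] at key
  rcases Sym2.eq_iff.1 key with h | h
  · have := ha.injOn _ (by omega) _ (by omega) (add_left_cancel (e.injective h.1)); omega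
  · have := ha.injOn _ (by omega) _ (by omega) (add_left_cancel (e.injective h.1)); omega

theorem card_le_maxOrthogonalCycleSystems [Nontrivial G] {n k : ℕ} (e : G ≃ Fin n)
    (htwo : ∀ d : G, d = -d → d = 0) {ι : Type*} [Fintype ι] (T : ι → Set (ℕ → G))
    (hT : ∀ s, IsStarter k (T s))
    (h : ∀ s t, s ≠ t → ∀ a ∈ T s, ∀ b ∈ T t, ∀ i < k, ∀ j < k, ∀ i' < k, ∀ j' < k,
      (a i = b i' ∨ a i = -b i') → (a j = b j' ∨ a j = -b j') → i = j) :
    Fintype.card ι ≤ maxOrthogonalCycleSystems k n := by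
  have horth : ∀ s t, s ≠ t →
      OrthogonalDecompositions (development e k (T s)) (development e k (T t)) := fun s t hst =>
    orthogonalDecompositions_development (hT s) (hT t) e (h s t hst)
  have hinj : Function.Injective fun s => development e k (T s) := by
    intro s t hst
    by_contra hne
    obtain ⟨d, hd⟩ := exists_ne (0 : G)
    obtain ⟨a, ha, -⟩ := (hT s).cover d hd
    have hmem : developedCycle e k a 0 ∈ development e k (T s) := ⟨a, ha, 0, rfl⟩
    have hst : development e k (T s) = development e k (T t) := hst
    -- Equal systems with different indices would be orthogonal to themselves, although each cycle
    -- has two distinct edges.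
    have := horth s t hne _ hmem _ (hst ▸ hmem)
    rw [Set.inter_self] at this
    exact ((hT s).simple a ha).not_subsingleton_edgeSet e 0 this
  refine (isGreatest_maxOrthogonalCycleSystems k n).2
    ⟨Set.range fun s => development e k (T s), ⟨?_, ?_⟩, ?_⟩
  · rintro _ ⟨s, rfl⟩
    exact (hT s).isCycleSystem e htwo
  · rintro _ ⟨s, rfl⟩ _ ⟨t, rfl⟩ hst
    exact horth s t fun hne => hst (by rw [hne])
  · rw [← Nat.card_coe_set_eq, Nat.card_range_of_injective hinj, Nat.card_eq_fintype_card]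

end Development

/-! ### Starters from cosets of roots of unity in a finite field. -/

section Cyclotomic

variable {F : Type*} [Field F]

theorem partialSum_mul (t : F) (a : ℕ → F) (n : ℕ) :
    partialSum (fun i => t * a i) n = t * partialSum a n :=
  (Finset.mul_sum _ _ _).symm

theorem IsSimpleZeroSum.mul {k : ℕ} {a : ℕ → F} (ha : IsSimpleZeroSum k a) {t : F} (ht : t ≠ 0) :
    IsSimpleZeroSum k fun i => t * a i := by
  refine ⟨ha.three_le, by rw [partialSum_mul, ha.sum_eq_zero, mul_zero], fun i hi j hj h => ?_⟩
  rw [partialSum_mul, partialSum_mul] at h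
  exact ha.injOn i hi j hj (mul_left_cancel₀ ht h)

theorem pow_eq_one_or_neg_pow_eq_one {w : ℕ} (hw : Odd w) {x : F} (hx : x ^ (2 * w) = 1) :
    x ^ w = 1 ∨ (-x) ^ w = 1 := by
  rw [mul_comm, pow_mul] at hx
  rcases sq_eq_sq_iff_eq_or_eq_neg.1 (hx.trans (one_pow 2).symm) with h | h
  · exact Or.inl h
  · exact Or.inr (by rw [hw.neg_pow, h, neg_neg])

/-- The multiples of `a` by the `w`-th roots of unity. -/
def rootMultiples (w : ℕ) (a : ℕ → F) : Set (ℕ → F) :=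
  {b | ∃ t : F, t ^ w = 1 ∧ b = fun i => t * a i}

/-- A simple zero-sum sequence whose first `k` terms represent the cosets of the group of
`2w`-th roots of unity. -/
structure IsTransversal (k w : ℕ) (a : ℕ → F) : Prop where
  simple : IsSimpleZeroSum k a
  pow_injOn : ∀ i < k, ∀ j < k, a i ^ (2 * w) = a j ^ (2 * w) → i = j

theorem pow_two_mul_eq {w : ℕ} {x t y u : F} (ht : t ^ w = 1) (hu : u ^ w = 1)
    (h : t * x = u * y ∨ t * x = -(u * y)) : x ^ (2 * w) = y ^ (2 * w) := by
  have ht2 : t ^ (2 * w) = 1 := by rw [mul_comm, pow_mul, ht, one_pow]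
  have hu2 : u ^ (2 * w) = 1 := by rw [mul_comm, pow_mul, hu, one_pow]
  have : (t * x) ^ (2 * w) = (u * y) ^ (2 * w) := by
    rcases h with h | h
    · rw [h]
    · rw [h, (even_two_mul w).neg_pow]
  rwa [mul_pow, mul_pow, ht2, hu2, one_mul, one_mul] at this

/-- Squaring removes the signs, and cross-multiplying eliminates the multipliers `t` and `u`: only
ratios of entries matter. -/
theorem sq_mul_eq_sq_mul {t u x y x' y' : F} (ht : t ≠ 0) (hu : u ≠ 0)
    (h : t * x = u * x' ∨ t * x = -(u * x')) (h' : t * y = u * y' ∨ t * y = -(u * y')) :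
    (x * y') ^ 2 = (y * x') ^ 2 := by
  have h := sq_eq_sq_iff_eq_or_eq_neg.2 h
  have h' := sq_eq_sq_iff_eq_or_eq_neg.2 h'
  refine mul_left_cancel₀ (pow_ne_zero 2 (mul_ne_zero ht hu)) ?_
  linear_combination (u * y') ^ 2 * h - (u * x') ^ 2 * h'

theorem ne_zero_of_pow_eq_one {w : ℕ} (hw : 0 < w) {t : F} (ht : t ^ w = 1) : t ≠ 0 := by
  rintro rfl
  rw [zero_pow hw.ne'] at ht
  exact zero_ne_one ht

/-- The condition on `a` and `b` under which the cycle systems they generate are orthogonal. -/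
def RatioDisjoint (k w : ℕ) (a b : ℕ → F) : Prop :=
  ∀ i < k, ∀ j < k, ∀ i' < k, ∀ j' < k, a i ^ (2 * w) = b i' ^ (2 * w) →
    a j ^ (2 * w) = b j' ^ (2 * w) → (a i * b j') ^ 2 = (a j * b i') ^ 2 → i = j

/-- The geometric progressions `m, mξ, mξ², …`, one for each coset of the group of `2k`-th roots
of unity. -/
def geometricMultiples (k : ℕ) (ξ : F) : Set (ℕ → F) :=
  {b | ∃ c : Fˣ ⧸ (powMonoidHom (2 * k) : Fˣ →* Fˣ).ker, b = fun i => (c.out : F) * ξ ^ i}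

/-- The partial sums are (ξ^i - 1)/(ξ - 1), which are distinct for i < k. -/
theorem isSimpleZeroSum_pow {k : ℕ} (hk : 3 ≤ k) {ξ : F} (hξ : IsPrimitiveRoot ξ k) :
    IsSimpleZeroSum k fun i => ξ ^ i := by
  have h1 : ξ - 1 ≠ 0 := sub_ne_zero.2 (hξ.ne_one (by omega))
  refine ⟨hk, hξ.geom_sum_eq_zero (by omega), fun i hi j hj h => ?_⟩
  have h := congrArg (· * (ξ - 1)) h
  simp only [partialSum, geom_sum_mul] at h
  exact hξ.pow_inj hi hj (sub_left_injective h)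

variable [Fintype F] {k w : ℕ}

theorem neg_ne_self_of_card (hq : Fintype.card F = 2 * k * w + 1) (d : F) (hd : d = -d) :
    d = 0 := by
  by_contra hne
  have h2 : (2 : F) * d = 0 := by rw [two_mul]; nth_rewrite 2 [hd]; exact add_neg_cancel d
  have h2 : (2 : F) = 0 := (mul_eq_zero.1 h2).resolve_right hne
  have hc := FiniteField.cast_card_eq_zero F
  rw [hq] at hc
  push_cast at hc
  rw [h2] at hc
  simp at hc

theorem IsTransversal.isStarter (hq : Fintype.card F = 2 * k * w + 1) (hw : Odd w)
    {a : ℕ → F} (ha : IsTransversal k w a) : IsStarter k (rootMultiples w a) := by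
  classical
  have hw0 : 0 < w := hw.pos
  refine ⟨?_, ?_, ?_⟩
  · rintro b ⟨t, ht, rfl⟩
    refine ha.simple.mul ?_
    rintro rfl
    rw [zero_pow hw0.ne'] at ht
    exact zero_ne_one ht
  · intro d hd
    have hroot : ∀ x : F, x ≠ 0 → (x ^ (2 * w)) ∈ Polynomial.nthRootsFinset k (1 : F) := by
      intro x hx
      rw [Polynomial.mem_nthRootsFinset (by have := ha.simple.three_le; omega), ← pow_mul]
      have := FiniteField.pow_card_sub_one_eq_one x hx
      rwa [hq, Nat.add_sub_cancel, show 2 * k * w = 2 * w * k by ring] at this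
    -- There are at most k k-th roots of unity, and the entries already produce k different ones.
    have himg : (range k).image (fun i => a i ^ (2 * w)) = Polynomial.nthRootsFinset k (1 : F) := by
      refine Finset.eq_of_subset_of_card_le ?_ ?_
      · intro x hx
        obtain ⟨i, hi, rfl⟩ := mem_image.1 hx
        exact hroot _ (ha.simple.ne_zero (mem_range.1 hi))
      · rw [Finset.card_image_of_injOn, card_range]
        · exact (Multiset.toFinset_card_le _).trans (Polynomial.card_nthRoots k 1)
        · intro i hi j hj
          exact ha.pow_injOn i (by simpa using hi) j (by simpa using hj)
    have hd' := hroot d hd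
    rw [← himg] at hd'
    obtain ⟨i, hi, hid⟩ := mem_image.1 hd'
    have hi := mem_range.1 hi
    have hne := ha.simple.ne_zero hi
    have h1 : (d / a i) ^ (2 * w) = 1 := by
      rw [div_pow, ← hid, div_self (pow_ne_zero _ hne)]
    rcases pow_eq_one_or_neg_pow_eq_one hw h1 with h | h
    · exact ⟨_, ⟨_, h, rfl⟩, i, hi, Or.inl (div_mul_cancel₀ _ hne)⟩
    · exact ⟨_, ⟨_, h, rfl⟩, i, hi, Or.inr (by rw [neg_mul, div_mul_cancel₀ _ hne])⟩
  · rintro _ ⟨t, ht, rfl⟩ _ ⟨u, hu, rfl⟩ i hi j hj h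
    obtain rfl := ha.pow_injOn i hi j hj (pow_two_mul_eq ht hu h)
    have hne := ha.simple.ne_zero hi
    rcases h with h | h
    · rw [mul_right_cancel₀ hne h]
      exact ⟨rfl, rfl⟩
    -- Here t = -u, which is impossible: w is odd, so t^w would be -1.
    · rw [← neg_mul] at h
      have h := mul_right_cancel₀ hne h
      rw [h, hw.neg_pow, hu] at ht
      exact absurd (neg_ne_self_of_card hq 1 ht.symm) one_ne_zero

theorem exists_isPrimitiveRoot {n m : ℕ} (hq : Fintype.card F = n * m + 1) (hnm : 0 < n * m) :
    ∃ ξ : F, IsPrimitiveRoot ξ n := by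
  obtain ⟨g, hg⟩ := IsCyclic.exists_ofOrder_eq_natCard (α := Fˣ)
  have hcard : Nat.card Fˣ = n * m := by
    rw [Nat.card_units, Nat.card_eq_fintype_card, hq, Nat.add_sub_cancel]
  have hp : IsPrimitiveRoot g (n * m) := by
    rw [← hcard, ← hg]
    exact IsPrimitiveRoot.orderOf g
  have := hp.pow hnm (mul_comm n m)
  exact ⟨_, this.map_of_injective (f := Units.coeHom F) Units.val_injective⟩

/-- For odd k the powers of ξ and their negatives are exactly the 2k-th roots of unity, so each
progression uses every pair {d, -d} of its coset once. -/
theorem isStarter_geometricMultiples (hq : Fintype.card F = 2 * k * w + 1) (hk : 3 ≤ k)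
    (hodd : Odd k) {ξ : F} (hξ : IsPrimitiveRoot ξ k) : IsStarter k (geometricMultiples k ξ) := by
  refine ⟨?_, ?_, ?_⟩
  · rintro b ⟨c, rfl⟩
    exact (isSimpleZeroSum_pow hk hξ).mul (Units.ne_zero _)
  · intro d hd
    have : NeZero k := ⟨by omega⟩
    set c : Fˣ ⧸ (powMonoidHom (2 * k) : Fˣ →* Fˣ).ker := QuotientGroup.mk (Units.mk0 d hd)
    have hc : (c.out)⁻¹ * Units.mk0 d hd ∈ (powMonoidHom (2 * k) : Fˣ →* Fˣ).ker :=
      QuotientGroup.eq.1 (QuotientGroup.out_eq' c)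
    have hc' : ((c.out : F)⁻¹ * d) ^ (2 * k) = 1 := by
      have := congrArg (Units.val) (MonoidHom.mem_ker.1 hc)
      simpa using this
    have hne : (c.out : F) ≠ 0 := Units.ne_zero _
    rcases pow_eq_one_or_neg_pow_eq_one hodd hc' with h | h
    · obtain ⟨i, hi, hi'⟩ := hξ.eq_pow_of_pow_eq_one h
      exact ⟨_, ⟨c, rfl⟩, i, hi, Or.inl (by simp only [hi']; rw [mul_inv_cancel_left₀ hne])⟩
    · obtain ⟨i, hi, hi'⟩ := hξ.eq_pow_of_pow_eq_one h
      exact ⟨_, ⟨c, rfl⟩, i, hi, Or.inr (by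
        simp only [hi']; rw [mul_neg, mul_inv_cancel_left₀ hne])⟩
  · rintro _ ⟨c, rfl⟩ _ ⟨d, rfl⟩ i hi j hj h
    simp only at h
    have hξ2 : ∀ n, (ξ ^ n) ^ (2 * k) = 1 := fun n => by
      rw [← pow_mul, mul_comm n, mul_assoc, mul_left_comm, pow_mul, hξ.pow_eq_one, one_pow]
    have hpow : ((c.out : F)) ^ (2 * k) = (d.out : F) ^ (2 * k) := by
      have : ((c.out : F) * ξ ^ i) ^ (2 * k) = ((d.out : F) * ξ ^ j) ^ (2 * k) := by
        rcases h with h | h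
        · rw [h]
        · rw [h, (even_two_mul k).neg_pow]
      rwa [mul_pow, mul_pow, hξ2, hξ2, mul_one, mul_one] at this
    have hcd : c = d := by
      rw [← QuotientGroup.out_eq' c, ← QuotientGroup.out_eq' d, QuotientGroup.eq,
        MonoidHom.mem_ker, powMonoidHom_apply]
      apply Units.val_injective
      push_cast
      rw [mul_pow, inv_pow, hpow, inv_mul_cancel₀ (pow_ne_zero _ (Units.ne_zero _))]
    subst hcd
    refine ⟨rfl, ?_⟩
    have hne : (c.out : F) ≠ 0 := Units.ne_zero _
    rcases h with h | h
    · exact hξ.pow_inj hi hj (mul_left_cancel₀ hne h)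
    · rw [← mul_neg] at h
      have h := congrArg (· ^ k) (mul_left_cancel₀ hne h)
      simp only [hodd.neg_pow, ← pow_mul] at h
      rw [mul_comm i, mul_comm j, pow_mul, pow_mul, hξ.pow_eq_one, one_pow, one_pow] at h
      exact absurd (neg_ne_self_of_card hq 1 h) one_ne_zero

theorem le_maxOrthogonalCycleSystems_of_ratioDisjoint (hq : Fintype.card F = 2 * k * w + 1)
    (hw : Odd w) {ι : Type*} [Fintype ι] (a : ι → ℕ → F) (ha : ∀ s, IsTransversal k w (a s))
    (hab : ∀ s t, s ≠ t → RatioDisjoint k w (a s) (a t)) :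
    Fintype.card ι ≤ maxOrthogonalCycleSystems k (2 * k * w + 1) := by
  refine card_le_maxOrthogonalCycleSystems (Fintype.equivFinOfCardEq hq)
    (neg_ne_self_of_card hq) (fun s => rootMultiples w (a s)) (fun s => (ha s).isStarter hq hw) ?_
  rintro s t hst _ ⟨x, hx, rfl⟩ _ ⟨y, hy, rfl⟩ i hi j hj i' hi' j' hj' h h'
  exact hab s t hst i hi j hj i' hi' j' hj' (pow_two_mul_eq hx hy h) (pow_two_mul_eq hx hy h')
    (sq_mul_eq_sq_mul (ne_zero_of_pow_eq_one hw.pos hx) (ne_zero_of_pow_eq_one hw.pos hy) h h')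

theorem one_le_maxOrthogonalCycleSystems (hq : Fintype.card F = 2 * k * w + 1) (hk : 3 ≤ k)
    (hodd : Odd k) (hw : 0 < w) : 1 ≤ maxOrthogonalCycleSystems k (2 * k * w + 1) := by
  obtain ⟨ξ, hξ⟩ := exists_isPrimitiveRoot (F := F) (n := k) (m := 2 * w)
    (by rw [hq]; ring) (by positivity)
  have := card_le_maxOrthogonalCycleSystems (k := k) (Fintype.equivFinOfCardEq hq)
    (neg_ne_self_of_card hq) (fun _ : Unit => geometricMultiples k ξ)
    (fun _ => isStarter_geometricMultiples hq hk hodd hξ)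
    (fun s t hst => absurd (Subsingleton.elim s t) hst)
  simpa using this

/-- When w = k, both constructions refer to the same cosets: a transversal has its entries in
distinct cosets of the 2k-th roots of unity, a progression has all of them in one. They therefore
share at most one term up to sign. -/
theorem succ_le_maxOrthogonalCycleSystems_of_ratioDisjoint
    (hq : Fintype.card F = 2 * k * k + 1) (hk : 3 ≤ k)
    (hodd : Odd k) {ι : Type*} [Fintype ι] (a : ι → ℕ → F) (ha : ∀ s, IsTransversal k k (a s))
    (hab : ∀ s t, s ≠ t → RatioDisjoint k k (a s) (a t)) :
    Fintype.card ι + 1 ≤ maxOrthogonalCycleSystems k (2 * k * k + 1) := by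
  obtain ⟨ξ, hξ⟩ := exists_isPrimitiveRoot (F := F) (n := k) (m := 2 * k)
    (by rw [hq]; ring) (by positivity)
  have hξ2 : ∀ n, (ξ ^ n) ^ 2 = (ξ ^ 2) ^ n := fun n => pow_right_comm ξ n 2
  have hξk : ∀ n, (ξ ^ n) ^ (2 * k) = 1 := fun n => by
    rw [← pow_mul, mul_comm n, mul_assoc, mul_left_comm, pow_mul, hξ.pow_eq_one, one_pow]
  have hmix : ∀ s, ∀ t u : F, t ^ k = 1 → ∀ i < k, ∀ j < k, ∀ i' j' : ℕ,
      (t * a s i = u * ξ ^ i' ∨ t * a s i = -(u * ξ ^ i')) →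
      (t * a s j = u * ξ ^ j' ∨ t * a s j = -(u * ξ ^ j')) → i = j := by
    intro s t u ht i hi j hj i' j' h h'
    have ht2 : t ^ (2 * k) = 1 := by rw [mul_comm, pow_mul, ht, one_pow]
    have key : ∀ x : F, ∀ n : ℕ, (t * x = u * ξ ^ n ∨ t * x = -(u * ξ ^ n)) →
        x ^ (2 * k) = u ^ (2 * k) := by
      intro x n h
      have : (t * x) ^ (2 * k) = (u * ξ ^ n) ^ (2 * k) := by
        rcases h with h | h
        · rw [h]
        · rw [h, (even_two_mul k).neg_pow]
      rwa [mul_pow, mul_pow, ht2, hξk, one_mul, mul_one] at this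
    exact (ha s).pow_injOn i hi j hj ((key _ _ h).trans (key _ _ h').symm)
  have hflip : ∀ x y : F, (x = y ∨ x = -y) → (y = x ∨ y = -x) := by
    rintro x y (rfl | rfl)
    · exact Or.inl rfl
    · exact Or.inr (neg_neg y).symm
  rw [← Fintype.card_option]
  refine card_le_maxOrthogonalCycleSystems (Fintype.equivFinOfCardEq hq)
    (neg_ne_self_of_card hq)
    (fun s => s.elim (geometricMultiples k ξ) fun s => rootMultiples k (a s)) ?_ ?_
  · rintro (_ | s)
    · exact isStarter_geometricMultiples hq hk hodd hξ
    · exact (ha s).isStarter hq hodd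
  · rintro (_ | s) (_ | t) hst
    · exact absurd rfl hst
    · rintro _ ⟨c, rfl⟩ _ ⟨y, hy, rfl⟩ i hi j hj i' hi' j' hj' h h'
      have hij' := hmix t y _ hy i' hi' j' hj' i j (hflip _ _ h) (hflip _ _ h')
      subst hij'
      have hsimple := (isStarter_geometricMultiples hq hk hodd hξ).unique _ ⟨c, rfl⟩ _ ⟨c, rfl⟩
        i hi j hj
      refine (hsimple ?_).2
      rcases h with h | h <;> rcases h' with h' | h' <;> simp [h, h']
    · rintro _ ⟨x, hx, rfl⟩ _ ⟨c, rfl⟩ i hi j hj i' hi' j' hj' h h'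
      exact hmix s x _ hx i hi j hj i' j' h h'
    · rintro _ ⟨x, hx, rfl⟩ _ ⟨y, hy, rfl⟩ i hi j hj i' hi' j' hj' h h'
      exact hab s t (fun h => hst (by rw [h])) i hi j hj i' hi' j' hj' (pow_two_mul_eq hx hy h)
        (pow_two_mul_eq hx hy h') (sq_mul_eq_sq_mul (ne_zero_of_pow_eq_one hodd.pos hx)
          (ne_zero_of_pow_eq_one hodd.pos hy) h h')

end Cyclotomic

/-! ### An incidence bound, and sums of elements of two prescribed cosets. -/

section Incidence

variable {F : Type*} [Field F] [Fintype F] [DecidableEq F]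

/-- The number of points of `P` on the line `y = l.1 * x + l.2`. -/
def incidence (P : Finset (F × F)) (l : F × F) : ℕ :=
  (P.filter fun p => p.2 = l.1 * p.1 + l.2).card

theorem card_lines_through (p : F × F) :
    (univ.filter fun l : F × F => p.2 = l.1 * p.1 + l.2).card = Fintype.card F := by
  rw [← Finset.card_univ]
  refine Finset.card_bij' (fun l _ => l.1) (fun m _ => (m, p.2 - m * p.1)) ?_ ?_ ?_ ?_
  · simp
  · simp
  · rintro ⟨m, c⟩ h
    simp only [mem_filter, mem_univ, true_and] at h
    simp [h]
  · simp

/-- Vertical lines are not parametrised, so two points with the same abscissa lie on none. -/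
theorem card_lines_through_two {p p' : F × F} (h : p ≠ p') :
    (univ.filter fun l : F × F => p.2 = l.1 * p.1 + l.2 ∧ p'.2 = l.1 * p'.1 + l.2).card ≤ 1 := by
  rw [Finset.card_le_one]
  rintro ⟨m, c⟩ hl ⟨m', c'⟩ hl'
  simp only [mem_filter, mem_univ, true_and] at hl hl'
  have hne : p.1 - p'.1 ≠ 0 := by
    intro h0
    refine h (Prod.ext (sub_eq_zero.1 h0) ?_)
    rw [hl.1, hl.2, sub_eq_zero.1 h0]
  have hm : m = m' := by
    refine mul_right_cancel₀ hne ?_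
    linear_combination hl'.1 - hl'.2 - hl.1 + hl.2
  subst hm
  have : c = c' := by linear_combination hl'.1 - hl.1
  rw [this]

theorem sum_incidence (P : Finset (F × F)) :
    ∑ l, incidence P l = Fintype.card F * P.card := by
  simp only [incidence, Finset.card_filter]
  rw [Finset.sum_comm]
  simp only [← Finset.card_filter]
  rw [Finset.sum_congr rfl fun p _ => card_lines_through p, Finset.sum_const, smul_eq_mul,
    mul_comm]

/-- Count ordered pairs of points by common lines: a diagonal pair has q of them, any other pair at
most one. -/
theorem sum_incidence_sq_le (P : Finset (F × F)) :
    ∑ l, incidence P l ^ 2 ≤ P.card ^ 2 + Fintype.card F * P.card := by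
  have h1 : ∀ l : F × F, incidence P l ^ 2 = ∑ p ∈ P, ∑ p' ∈ P,
      if p.2 = l.1 * p.1 + l.2 ∧ p'.2 = l.1 * p'.1 + l.2 then 1 else 0 := by
    intro l
    rw [incidence, sq, Finset.card_filter, Finset.sum_mul_sum]
    refine Finset.sum_congr rfl fun p _ => Finset.sum_congr rfl fun p' _ => ?_
    split_ifs <;> simp_all
  simp only [h1]
  rw [Finset.sum_comm]
  calc ∑ p ∈ P, ∑ l : F × F, ∑ p' ∈ P,
        (if p.2 = l.1 * p.1 + l.2 ∧ p'.2 = l.1 * p'.1 + l.2 then 1 else 0)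
      ≤ ∑ p ∈ P, (P.card + Fintype.card F) := by
        refine Finset.sum_le_sum fun p hp => ?_
        rw [Finset.sum_comm]
        calc ∑ p' ∈ P, ∑ l : F × F,
              (if p.2 = l.1 * p.1 + l.2 ∧ p'.2 = l.1 * p'.1 + l.2 then 1 else 0)
            ≤ ∑ p' ∈ P, (1 + if p = p' then Fintype.card F else 0) := by
              refine Finset.sum_le_sum fun p' _ => ?_
              rw [← Finset.card_filter]
              split_ifs with h
              · subst h
                simp only [and_self, card_lines_through]
                omega
              · simpa using card_lines_through_two h
          _ = P.card + Fintype.card F := by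
              rw [Finset.sum_add_distrib, Finset.sum_ite_eq]
              simp [hp]
    _ = P.card ^ 2 + Fintype.card F * P.card := by
        rw [Finset.sum_const, smul_eq_mul]; ring

/-- The first two moments bound the total squared deviation of `incidence P` from its mean |P|/q
over all q² lines by q|P|; Cauchy–Schwarz restricts this to `L`. -/
theorem sq_incidences_sub_le (P L : Finset (F × F)) :
    (∑ l ∈ L, (incidence P l : ℝ) - P.card * L.card / Fintype.card F) ^ 2 ≤
      Fintype.card F * P.card * L.card := by
  set q : ℝ := (Fintype.card F : ℝ) with hqdef
  have hq : 0 < q := by rw [hqdef]; exact_mod_cast Fintype.card_pos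
  have e1 : ∑ l, (incidence P l : ℝ) = q * P.card := by
    rw [hqdef]; exact_mod_cast sum_incidence P
  have e2 : ∑ l, (incidence P l : ℝ) ^ 2 ≤ (P.card : ℝ) ^ 2 + q * P.card := by
    rw [hqdef]; exact_mod_cast sum_incidence_sq_le P
  have hvar : ∑ l, ((incidence P l : ℝ) - P.card / q) ^ 2 ≤ q * P.card := by
    have : ∑ l, ((incidence P l : ℝ) - P.card / q) ^ 2 =
        ∑ l, (incidence P l : ℝ) ^ 2 - (P.card : ℝ) ^ 2 := by
      simp only [sub_sq, Finset.sum_add_distrib, Finset.sum_sub_distrib, Finset.sum_const,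
        ← Finset.sum_mul, ← Finset.mul_sum, e1, Finset.card_univ, Fintype.card_prod, nsmul_eq_mul,
        Nat.cast_mul]
      change _ + q * q * _ = _
      field_simp
      ring
    linarith
  calc (∑ l ∈ L, (incidence P l : ℝ) - P.card * L.card / q) ^ 2
      = (∑ l ∈ L, ((incidence P l : ℝ) - P.card / q)) ^ 2 := by
        rw [Finset.sum_sub_distrib, Finset.sum_const, nsmul_eq_mul]; ring
    _ ≤ L.card * ∑ l ∈ L, ((incidence P l : ℝ) - P.card / q) ^ 2 := sq_sum_le_card_mul_sum_sq
    _ ≤ L.card * (q * P.card) := by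
        refine mul_le_mul_of_nonneg_left (le_trans ?_ hvar) (Nat.cast_nonneg _)
        exact Finset.sum_le_sum_of_subset_of_nonneg (Finset.subset_univ _)
          fun _ _ _ => sq_nonneg _
    _ = q * P.card * L.card := by ring

/-- The elements with the same `n`-th power as `y`. -/
def powFiber (n : ℕ) (y : F) : Finset F := univ.filter fun x => x ^ n = y ^ n

@[simp]
theorem mem_powFiber {n : ℕ} {x y : F} : x ∈ powFiber n y ↔ x ^ n = y ^ n := by
  simp [powFiber]

variable {k w : ℕ}

theorem card_powFiber (hq : Fintype.card F = 2 * k * w + 1) (hk : 0 < k) (hw : 0 < w) {y : F}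
    (hy : y ≠ 0) : (powFiber (2 * w) y).card = 2 * w := by
  obtain ⟨ζ, hζ⟩ := exists_isPrimitiveRoot (F := F) (n := 2 * w) (m := k)
    (by rw [hq]; ring) (by positivity)
  have h : powFiber (2 * w) y = (Polynomial.nthRoots (2 * w) (y ^ (2 * w))).toFinset := by
    ext x
    rw [mem_powFiber, Multiset.mem_toFinset, Polynomial.mem_nthRoots (by positivity)]
  rw [h, Multiset.toFinset_card_of_nodup (hζ.nthRoots_nodup (pow_ne_zero _ hy)),
    hζ.card_nthRoots, if_pos ⟨y, rfl⟩]

/-- With W the 2w-th roots of unity, take the points W × sW and the lines with slope in the coset of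
`y` and intercept in that of `z`. Incidence st = mx + c says s = mx/t + c/t, a decomposition of the
required kind, and each decomposition arises at most once per point. -/
theorem card_add_eq_ge (hq : Fintype.card F = 2 * k * w + 1) (hk : 0 < k) (hw : 0 < w)
    {y z s : F} (hy : y ≠ 0) (hz : z ≠ 0) (hs : s ≠ 0) :
    ((2 * w : ℝ)) ^ 2 / (2 * k * w + 1) - √(2 * k * w + 1) ≤
      ((powFiber (2 * w) y).filter fun x => s - x ∈ powFiber (2 * w) z).card := by
  set N := ((powFiber (2 * w) y).filter fun x => s - x ∈ powFiber (2 * w) z) with hN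
  set W := powFiber (2 * w) (1 : F) with hW
  set P := W ×ˢ W.image (s * ·) with hP
  set L := powFiber (2 * w) y ×ˢ powFiber (2 * w) z with hL
  have hw1 : ∀ x ∈ W, x ^ (2 * w) = 1 := fun x hx => by
    rw [hW, mem_powFiber] at hx; rw [hx, one_pow]
  have hWcard : W.card = 2 * w := card_powFiber hq hk hw one_ne_zero
  have hPcard : P.card = 2 * w * (2 * w) := by
    rw [hP, Finset.card_product, Finset.card_image_of_injective _ (mul_right_injective₀ hs), hWcard]
  have hLcard : L.card = 2 * w * (2 * w) := by
    rw [hL, Finset.card_product, card_powFiber hq hk hw hy, card_powFiber hq hk hw hz]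
  have hle : ∑ l ∈ L, incidence P l ≤ N.card * (2 * w * (2 * w)) := by
    have : ∑ l ∈ L, incidence P l = (L.sigma fun l => P.filter fun p =>
        p.2 = l.1 * p.1 + l.2).card := by
      rw [Finset.card_sigma]; rfl
    rw [this, ← hPcard, ← Finset.card_product]
    refine Finset.card_le_card_of_injOn
      -- The second coordinate of the point is st, so the first component is mx/t.
      (fun a => (a.1.1 * a.2.1 * s / a.2.2, a.2)) ?_ ?_
    · rintro ⟨⟨m, c⟩, ⟨x, v⟩⟩ h
      simp only [coe_sigma, Set.mem_sigma_iff, mem_coe, mem_filter, hL, hP, mem_product,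
        mem_image, mem_powFiber] at h
      obtain ⟨⟨hm, hc⟩, ⟨hx, t, ht, rfl⟩, hinc⟩ := h
      have ht1 := hw1 t ht
      have ht0 : t ≠ 0 := ne_zero_of_pow_eq_one (by positivity) ht1
      have hx1 := hw1 x hx
      have e1 : m * x * s / (s * t) = m * x / t := by field_simp
      have e2 : s - m * x / t = c / t := by
        field_simp
        linear_combination hinc
      simp only [hN, hP, mem_coe, mem_product, mem_filter, mem_image, mem_powFiber, e1, e2]
      refine ⟨⟨?_, ?_⟩, hx, t, ht, rfl⟩
      · rw [div_pow, mul_pow, hx1, ht1, hm, mul_one, div_one]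
      · rw [div_pow, ht1, hc, div_one]
    · rintro ⟨⟨m, c⟩, ⟨x, v⟩⟩ h ⟨⟨m', c'⟩, ⟨x', v'⟩⟩ h' heq
      simp only [coe_sigma, Set.mem_sigma_iff, mem_coe, mem_filter, hL, hP, mem_product,
        mem_image] at h h'
      obtain ⟨-, ⟨hx, t, ht, rfl⟩, hinc⟩ := h
      obtain ⟨-, -, hinc'⟩ := h'
      simp only [Prod.mk.injEq] at heq
      obtain ⟨h1, rfl, rfl⟩ := heq
      have ht0 : t ≠ 0 := ne_zero_of_pow_eq_one (by positivity) (hw1 t ht)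
      have hx0 : x ≠ 0 := ne_zero_of_pow_eq_one (by positivity) (hw1 x hx)
      have hm : m = m' := by
        field_simp at h1
        exact h1
      subst hm
      have hc : c = c' := by linear_combination hinc' - hinc
      rw [hc]
  have hmain := sq_incidences_sub_le P L
  rw [hPcard, hLcard, hq] at hmain
  have hle' : ∑ l ∈ L, (incidence P l : ℝ) ≤ N.card * (2 * w) ^ 2 := by
    have : ((∑ l ∈ L, incidence P l : ℕ) : ℝ) ≤ (N.card * (2 * w * (2 * w)) : ℕ) := by
      exact_mod_cast hle
    push_cast at this
    nlinarith
  have habs := Real.abs_le_sqrt hmain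
  push_cast at habs
  have hw0 : (0 : ℝ) < (2 * w) ^ 2 := by positivity
  rw [show ((2 : ℝ) * k * w + 1) * (2 * w * (2 * w)) * (2 * w * (2 * w)) =
    (2 * k * w + 1) * ((2 * w) ^ 2) ^ 2 by ring, Real.sqrt_mul (by positivity),
    Real.sqrt_sq hw0.le] at habs
  have hlow := (abs_le.1 habs).1
  refine le_of_mul_le_mul_right ?_ hw0
  have e : ((2 : ℝ) * w * (2 * w) * (2 * w * (2 * w))) / (2 * k * w + 1) =
    (2 * w) ^ 2 / (2 * k * w + 1) * (2 * w) ^ 2 := by ring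
  rw [e] at hlow
  linarith

end Incidence

/-! ### Greedy construction of ratio-disjoint transversals. -/

section Greedy

variable {F : Type*} [Field F]

/-- The first `m` terms of `a` lie in the prescribed power classes, have distinct partial sums,
and have no ratio in common, up to sign, with `b 0, …, b (r - 1)`. -/
structure IsPartialTransversal (w : ℕ) (θ : ℕ → F) (b : ℕ → ℕ → F) (r m : ℕ) (a : ℕ → F) :
    Prop where
  pow_eq : ∀ i < m, a i ^ (2 * w) = θ i ^ (2 * w)
  injOn : ∀ i ≤ m, ∀ j ≤ m, partialSum a i = partialSum a j → i = j
  ratio : ∀ s < r, ∀ i < m, ∀ j < m, (a i * b s j) ^ 2 = (a j * b s i) ^ 2 → i = j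

variable {w : ℕ} {θ : ℕ → F} {b : ℕ → ℕ → F} {r m : ℕ} {a : ℕ → F}

theorem partialSum_update (a : ℕ → F) (m : ℕ) (x : F) {i : ℕ} (hi : i ≤ m) :
    partialSum (Function.update a m x) i = partialSum a i :=
  Finset.sum_congr rfl fun j hj => by
    rw [Function.update_of_ne]
    have := mem_range.1 hj
    omega

theorem partialSum_update_succ (a : ℕ → F) (m : ℕ) (x : F) :
    partialSum (Function.update a m x) (m + 1) = partialSum a m + x := by
  rw [partialSum_succ, partialSum_update a m x le_rfl, Function.update_self]

theorem IsPartialTransversal.ratio_update (ha : IsPartialTransversal w θ b r m a) {x : F}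
    (h : ∀ s < r, ∀ j < m, (x * b s j) ^ 2 ≠ (a j * b s m) ^ 2) :
    ∀ s < r, ∀ i < m + 1, ∀ j < m + 1,
      (Function.update a m x i * b s j) ^ 2 = (Function.update a m x j * b s i) ^ 2 → i = j := by
  intro s hs i hi j hj hij
  rcases Nat.lt_succ_iff_lt_or_eq.1 hi with hi | rfl <;>
    rcases Nat.lt_succ_iff_lt_or_eq.1 hj with hj | rfl
  · rw [Function.update_of_ne hi.ne, Function.update_of_ne hj.ne] at hij
    exact ha.ratio s hs i hi j hj hij
  · rw [Function.update_of_ne hi.ne, Function.update_self] at hij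
    exact absurd hij.symm (h s hs i hi)
  · rw [Function.update_of_ne hj.ne, Function.update_self] at hij
    exact absurd hij (h s hs j hj)
  · rfl

theorem IsPartialTransversal.pow_eq_update (ha : IsPartialTransversal w θ b r m a) {x : F}
    (hx : x ^ (2 * w) = θ m ^ (2 * w)) :
    ∀ i < m + 1, Function.update a m x i ^ (2 * w) = θ i ^ (2 * w) := by
  intro i hi
  rcases Nat.lt_succ_iff_lt_or_eq.1 hi with hi | rfl
  · rw [Function.update_of_ne hi.ne]
    exact ha.pow_eq i hi
  · rwa [Function.update_self]

theorem IsPartialTransversal.update (ha : IsPartialTransversal w θ b r m a) {x : F}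
    (hx : x ^ (2 * w) = θ m ^ (2 * w)) (hsum : ∀ i ≤ m, x ≠ partialSum a i - partialSum a m)
    (h : ∀ s < r, ∀ j < m, (x * b s j) ^ 2 ≠ (a j * b s m) ^ 2) :
    IsPartialTransversal w θ b r (m + 1) (Function.update a m x) := by
  refine ⟨ha.pow_eq_update hx, ?_, ha.ratio_update h⟩
  intro i hi j hj hij
  rcases Nat.le_succ_iff.1 hi with hi | rfl <;> rcases Nat.le_succ_iff.1 hj with hj | rfl
  · rw [partialSum_update _ _ _ hi, partialSum_update _ _ _ hj] at hij
    exact ha.injOn i hi j hj hij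
  · rw [partialSum_update _ _ _ hi, partialSum_update_succ] at hij
    exact absurd (eq_sub_of_add_eq' hij.symm) (hsum i hi)
  · rw [partialSum_update _ _ _ hj, partialSum_update_succ] at hij
    exact absurd (eq_sub_of_add_eq' hij) (hsum j hj)
  · rfl

/-- Sequences listing the cosets in the same order can only match at equal positions, so only ratios
at the same pair of positions need comparing. -/
theorem ratioDisjoint_of_pow_eq {k w : ℕ} {θ : ℕ → F}
    (hinj : ∀ i < k, ∀ j < k, θ i ^ (2 * w) = θ j ^ (2 * w) → i = j) {a b : ℕ → F}
    (ha : ∀ i < k, a i ^ (2 * w) = θ i ^ (2 * w)) (hb : ∀ i < k, b i ^ (2 * w) = θ i ^ (2 * w))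
    (h : ∀ i < k, ∀ j < k, (a i * b j) ^ 2 = (a j * b i) ^ 2 → i = j) : RatioDisjoint k w a b := by
  intro i hi j hj i' hi' j' hj' hii hjj hsq
  rw [ha i hi, hb i' hi'] at hii
  rw [ha j hj, hb j' hj'] at hjj
  obtain rfl := hinj i hi i' hi' hii
  obtain rfl := hinj j hj j' hj' hjj
  exact h i hi j hj hsq

theorem eq_div_or_eq_neg_div {x y c d : F} (hd : d ≠ 0) (h : (x * d) ^ 2 = (y * c) ^ 2) :
    x = y * c / d ∨ x = -(y * c / d) := by
  rcases sq_eq_sq_iff_eq_or_eq_neg.1 h with h | h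
  · exact Or.inl (eq_div_of_mul_eq hd h)
  · exact Or.inr (by rw [← neg_div]; exact eq_div_of_mul_eq hd h)

variable [DecidableEq F]

/-- The elements that may not be appended to the first `m` terms of `a`. -/
def excluded (b : ℕ → ℕ → F) (r m : ℕ) (a : ℕ → F) : Finset F :=
  (range (m + 1)).image (fun i => partialSum a i - partialSum a m) ∪
    ((range r ×ˢ range m).image (fun p => a p.2 * b p.1 m / b p.1 p.2) ∪
      (range r ×ˢ range m).image fun p => -(a p.2 * b p.1 m / b p.1 p.2))

theorem card_excluded_le (b : ℕ → ℕ → F) (r m : ℕ) (a : ℕ → F) :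
    (excluded b r m a).card ≤ m + 1 + 2 * (r * m) := by
  have h1 : ∀ f : ℕ × ℕ → F, ((range r ×ˢ range m).image f).card ≤ r * m := fun f =>
    card_image_le.trans (by simp)
  have h2 : ∀ f : ℕ → F, ((range (m + 1)).image f).card ≤ m + 1 := fun f =>
    card_image_le.trans (by simp)
  refine (card_union_le _ _).trans ?_
  have := card_union_le ((range r ×ˢ range m).image (fun p => a p.2 * b p.1 m / b p.1 p.2))
    ((range r ×ˢ range m).image fun p => -(a p.2 * b p.1 m / b p.1 p.2))
  have := h1 (fun p => a p.2 * b p.1 m / b p.1 p.2)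
  have := h1 (fun p => -(a p.2 * b p.1 m / b p.1 p.2))
  have := h2 (fun i => partialSum a i - partialSum a m)
  omega

theorem IsPartialTransversal.update_of_notMem (ha : IsPartialTransversal w θ b r m a)
    (hb : ∀ s < r, ∀ i ≤ m, b s i ≠ 0) {x : F} (hx : x ^ (2 * w) = θ m ^ (2 * w))
    (hx' : x ∉ excluded b r m a) :
    IsPartialTransversal w θ b r (m + 1) (Function.update a m x) := by
  simp only [excluded, mem_union, mem_image, mem_range, mem_product, not_or, not_exists,
    not_and] at hx'
  refine ha.update hx (fun i hi h => hx'.1 i (by omega) h.symm) fun s hs j hj h => ?_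
  rcases eq_div_or_eq_neg_div (hb s hs j hj.le) h with h | h
  · exact hx'.2.1 (s, j) ⟨hs, hj⟩ h.symm
  · exact hx'.2.2 (s, j) ⟨hs, hj⟩ h.symm

variable [Fintype F] {k : ℕ}

/-- Each coset offers 2w candidates, more than are excluded at any stage. -/
theorem exists_isPartialTransversal (hq : Fintype.card F = 2 * k * w + 1) (hk : 0 < k)
    (hw : 0 < w) (hθ : ∀ i, θ i ≠ 0) (hb : ∀ s < r, ∀ i < k, b s i ≠ 0)
    (hcard : k + 2 * (r * k) < 2 * w) : ∀ m < k, ∃ a, IsPartialTransversal w θ b r m a := by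
  intro m
  induction m with
  | zero =>
    exact fun _ => ⟨0, fun i hi => absurd hi (Nat.not_lt_zero i), fun i hi j hj _ => by omega,
      fun s _ i hi => absurd hi (Nat.not_lt_zero i)⟩
  | succ m ih =>
    intro hm
    obtain ⟨a, ha⟩ := ih (by omega)
    have hlt : (excluded b r m a).card < (powFiber (2 * w) (θ m)).card := by
      rw [card_powFiber hq hk hw (hθ m)]
      have := card_excluded_le b r m a
      have : r * m ≤ r * k := Nat.mul_le_mul_left r (by omega)
      omega
    obtain ⟨x, hx, hx'⟩ := Finset.exists_mem_notMem_of_card_lt_card hlt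
    exact ⟨_, ha.update_of_notMem (fun s hs i hi => hb s hs i (by omega))
      (mem_powFiber.1 hx) hx'⟩

/-- A complete transversal, in the sense of `IsPartialTransversal`, with sum zero. -/
structure IsNormalizedTransversal (k w : ℕ) (θ : ℕ → F) (b : ℕ → ℕ → F) (r : ℕ) (a : ℕ → F) :
    Prop where
  simple : IsSimpleZeroSum k a
  pow_eq : ∀ i < k, a i ^ (2 * w) = θ i ^ (2 * w)
  ratio : ∀ s < r, ∀ i < k, ∀ j < k, (a i * b s j) ^ 2 = (a j * b s i) ^ 2 → i = j

/-- The first k - 2 entries are chosen freely; the last two must be x and s₀ - x in their cosets,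
where s₀ ≠ 0 since l > 0. Once x keeps the partial sums distinct, the final entry closes the cycle
automatically. -/
theorem exists_isNormalizedTransversal {l : ℕ} (hk : k = l + 2) (hl : 0 < l)
    (hq : Fintype.card F = 2 * k * w + 1) (hw : 0 < w) (hθ : ∀ i, θ i ≠ 0)
    (hb : ∀ s < r, ∀ i < k, b s i ≠ 0) (hcard : k + 2 * (r * k) < 2 * w)
    (hcard' : (k + 4 * (r * k) : ℝ) <
      (2 * w : ℝ) ^ 2 / (2 * k * w + 1) - √(2 * k * w + 1)) :
    ∃ a, IsNormalizedTransversal k w θ b r a := by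
  obtain ⟨a, ha⟩ := exists_isPartialTransversal hq (by omega) hw hθ hb hcard l (by omega)
  set s₀ := -partialSum a l with hs₀
  have hne : s₀ ≠ 0 := by
    intro h
    have := ha.injOn l le_rfl 0 (by omega) (by rw [neg_eq_zero.1 h]; simp [partialSum])
    omega
  set X := (powFiber (2 * w) (θ l)).filter fun x => s₀ - x ∈ powFiber (2 * w) (θ (l + 1)) with hX
  have hXcard : k + 4 * (r * k) < X.card := by
    have := hcard'.trans_le (card_add_eq_ge hq (by omega) hw (hθ l) (hθ (l + 1)) hne)
    exact_mod_cast this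
  -- Beyond the values excluded for x itself, the next two sets keep s₀ - x from repeating a ratio
  -- with an earlier entry, and the last two keep the pair x, s₀ - x from repeating one, with either
  -- sign.
  set B := excluded b r l a ∪
    (((range r ×ˢ range l).image (fun p => s₀ - a p.2 * b p.1 (l + 1) / b p.1 p.2) ∪
      (range r ×ˢ range l).image (fun p => s₀ + a p.2 * b p.1 (l + 1) / b p.1 p.2)) ∪
    ((range r).image (fun s => s₀ * b s l / (b s (l + 1) + b s l)) ∪
      (range r).image (fun s => -(s₀ * b s l) / (b s (l + 1) - b s l)))) with hB
  have hBcard : B.card < X.card := by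
    refine lt_of_le_of_lt ?_ hXcard
    have h1 : ∀ f : ℕ × ℕ → F, ((range r ×ˢ range l).image f).card ≤ r * l := fun f =>
      card_image_le.trans (by simp)
    have h2 : ∀ f : ℕ → F, ((range r).image f).card ≤ r := fun f =>
      card_image_le.trans (by simp)
    have h3 := card_excluded_le b r l a
    have hrk : r * k = r * l + 2 * r := by rw [hk]; ring
    refine (card_union_le _ _).trans ?_
    refine (Nat.add_le_add h3 ((card_union_le _ _).trans (Nat.add_le_add
      ((card_union_le _ _).trans (Nat.add_le_add (h1 _) (h1 _)))
      ((card_union_le _ _).trans (Nat.add_le_add (h2 _) (h2 _)))))).trans ?_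
    omega
  obtain ⟨x, hx, hxB⟩ := Finset.exists_mem_notMem_of_card_lt_card hBcard
  simp only [hX, mem_filter, mem_powFiber] at hx
  simp only [hB, mem_union, mem_image, mem_range, mem_product, not_or, not_exists,
    not_and] at hxB
  obtain ⟨hx1, hx2⟩ := hx
  obtain ⟨hxe, ⟨hb1, hb2⟩, hb3, hb4⟩ := hxB
  have ha' := ha.update_of_notMem (fun s hs i hi => hb s hs i (by omega)) hx1 hxe
  set a' := Function.update a l x with ha'def
  have hS : partialSum a' (l + 1) = partialSum a l + x := partialSum_update_succ a l x
  have hratio := ha'.ratio_update (x := s₀ - x) (by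
    intro s hs j hj h
    have hbl1 := hb s hs (l + 1) (by omega)
    have hbl := hb s hs l (by omega)
    rcases Nat.lt_succ_iff_lt_or_eq.1 hj with hj | rfl
    · rw [ha'def, Function.update_of_ne hj.ne] at h
      rcases eq_div_or_eq_neg_div (hb s hs j (by omega)) h with h | h
      · exact hb1 (s, j) ⟨hs, hj⟩ (by simp only [← h]; ring)
      · exact hb2 (s, j) ⟨hs, hj⟩ (by simp only [← neg_eq_iff_eq_neg.2 h]; ring)
    · rw [ha'def, Function.update_self] at h
      rcases sq_eq_sq_iff_eq_or_eq_neg.1 h with h | h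
      · have h : x * (b s (j + 1) + b s j) = s₀ * b s j := by linear_combination -h
        refine hb3 s hs (eq_div_of_mul_eq (fun h0 => ?_) h).symm
        rw [h0, mul_zero] at h
        exact mul_ne_zero hne hbl h.symm
      · have h : x * (b s (j + 1) - b s j) = -(s₀ * b s j) := by linear_combination h
        refine hb4 s hs (eq_div_of_mul_eq (fun h0 => ?_) h).symm
        rw [h0, mul_zero] at h
        exact neg_ne_zero.2 (mul_ne_zero hne hbl) h.symm)
  subst hk
  refine ⟨Function.update a' (l + 1) (s₀ - x), ⟨by omega, ?_, ?_⟩, ha'.pow_eq_update hx2, hratio⟩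
  · rw [partialSum_update_succ, hS, hs₀]
    ring
  · intro i hi j hj hij
    rw [partialSum_update _ _ _ (Nat.lt_succ_iff.1 hi),
      partialSum_update _ _ _ (Nat.lt_succ_iff.1 hj)] at hij
    exact ha'.injOn i (by omega) j (by omega) hij

/-- Everything is compared with w/k: the fraction is at least 3/2 of it, the square root at most 1,
the left side less than 1/2. -/
theorem add_four_mul_lt_of_lt {k w r : ℕ} (hk : 3 ≤ k) (hw : 4 * k ^ 4 < w)
    (hr : 4 * k ^ 4 * r < w) : (k + 4 * (r * k) : ℝ) <
      (2 * w : ℝ) ^ 2 / (2 * k * w + 1) - √(2 * k * w + 1) := by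
  have hk' : (3 : ℝ) ≤ k := by exact_mod_cast hk
  have hw' : (4 : ℝ) * k ^ 4 < w := by exact_mod_cast hw
  have hr' : (4 : ℝ) * k ^ 4 * r < w := by exact_mod_cast hr
  have hk0 : (0 : ℝ) < k := by linarith
  have hk2 : (9 : ℝ) ≤ k ^ 2 := by nlinarith
  have hk3 : (27 : ℝ) ≤ k ^ 3 := by nlinarith
  have hw0 : (0 : ℝ) < w := lt_trans (by positivity) hw'
  have hkw : (1 : ℝ) ≤ k * w := by
    have : (1 : ℝ) ≤ w := by nlinarith [pow_pos hk0 4, mul_pos hk0 (pow_pos hk0 3)]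
    nlinarith
  have h1 : (3 / 2 : ℝ) * (w / k) ≤ (2 * w) ^ 2 / (2 * k * w + 1) := by
    rw [mul_div_assoc', div_le_div_iff₀ hk0 (by positivity)]
    nlinarith
  have h2 : √(2 * k * w + 1) ≤ (w / k : ℝ) := by
    rw [Real.sqrt_le_left (by positivity), div_pow, le_div_iff₀ (by positivity)]
    have : (4 : ℝ) * k ^ 4 * w ≤ w ^ 2 := by nlinarith
    have h3 : (2 * k * w + 1) * (k : ℝ) ^ 2 ≤ 3 * k ^ 3 * w := by nlinarith [pow_pos hk0 2]
    have h4 : 3 * (k : ℝ) ^ 3 * w ≤ 4 * k ^ 4 * w := by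
      have : (0 : ℝ) < k ^ 3 * w := by positivity
      nlinarith
    linarith
  have h3 : (k + 4 * (r * k) : ℝ) < 1 / 2 * (w / k) := by
    rw [mul_div_assoc', lt_div_iff₀ hk0]
    have e1 : 9 * (4 * (r : ℝ) * k ^ 2) ≤ 4 * k ^ 4 * r := by
      have : (0 : ℝ) ≤ r * k ^ 2 := by positivity
      nlinarith
    have e2 : 36 * (k : ℝ) ^ 2 ≤ 4 * k ^ 4 := by nlinarith [pow_pos hk0 2]
    nlinarith
  linarith

theorem exists_ratioDisjoint_family (hk : 3 ≤ k) (hq : Fintype.card F = 2 * k * w + 1)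
    (hw : 4 * k ^ 4 < w) (hθ : ∀ i, θ i ≠ 0) :
    ∀ r, 4 * k ^ 4 * r < w → ∃ b : ℕ → ℕ → F,
      ∀ s ≤ r, IsNormalizedTransversal k w θ b s (b s) := by
  have hw0 : 0 < w := by omega
  have step : ∀ (r : ℕ) (b : ℕ → ℕ → F), 4 * k ^ 4 * r < w →
      (∀ s < r, IsNormalizedTransversal k w θ b s (b s)) →
      ∃ a, IsNormalizedTransversal k w θ b r a := by
    intro r b hr hb
    obtain ⟨l, rfl⟩ : ∃ l, k = l + 2 := ⟨k - 2, by omega⟩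
    refine exists_isNormalizedTransversal rfl (by omega) hq hw0 hθ
      (fun s hs i hi => (hb s hs).simple.ne_zero hi) ?_ (add_four_mul_lt_of_lt hk hw hr)
    set k := l + 2
    have h1 : k * 1 ≤ k * k ^ 3 := Nat.mul_le_mul_left k (Nat.one_le_pow _ _ (by omega))
    have h2 : r * (k * 1) ≤ r * (k * k ^ 3) := Nat.mul_le_mul_left r h1
    nlinarith
  intro r
  induction r with
  | zero =>
    intro hr
    obtain ⟨a, ha⟩ := step 0 0 hr fun s hs => absurd hs (Nat.not_lt_zero s)
    refine ⟨fun _ => a, fun s hs => ?_⟩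
    obtain rfl : s = 0 := by omega
    exact ⟨ha.simple, ha.pow_eq, fun s hs => absurd hs (Nat.not_lt_zero s)⟩
  | succ r ih =>
    intro hr
    obtain ⟨b, hb⟩ := ih (lt_of_le_of_lt (Nat.mul_le_mul_left _ (Nat.le_succ r)) hr)
    obtain ⟨a, ha⟩ := step (r + 1) b hr fun s hs => hb s (by omega)
    refine ⟨Function.update b (r + 1) a, fun s hs => ?_⟩
    have hlt : ∀ t < s, Function.update b (r + 1) a t = b t := fun t ht =>
      Function.update_of_ne (by omega) _ _
    rcases Nat.le_succ_iff.1 hs with hs | rfl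
    · rw [Function.update_of_ne (by omega)]
      exact ⟨(hb s hs).simple, (hb s hs).pow_eq, fun t ht => by
        rw [hlt t ht]; exact (hb s hs).ratio t ht⟩
    · rw [Function.update_self]
      exact ⟨ha.simple, ha.pow_eq, fun t ht => by rw [hlt t ht]; exact ha.ratio t ht⟩

theorem ceil_le_maxOrthogonalCycleSystems (hk : 3 ≤ k) (hodd : Odd (k * w))
    (hq : Fintype.card F = 2 * k * w + 1) :
    ⌈(w : ℚ) / (4 * (k : ℚ) ^ 4)⌉₊ ≤ maxOrthogonalCycleSystems k (2 * k * w + 1) := by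
  obtain ⟨hkodd, hwodd⟩ := Nat.odd_mul.1 hodd
  have hk0 : (0 : ℚ) < 4 * (k : ℚ) ^ 4 := by
    have : (0 : ℚ) < k := by exact_mod_cast (by omega : 0 < k)
    positivity
  obtain hle | hlt := Nat.lt_or_ge 1 ⌈(w : ℚ) / (4 * (k : ℚ) ^ 4)⌉₊ |>.symm
  · exact hle.trans (one_le_maxOrthogonalCycleSystems hq hk hkodd hwodd.pos)
  obtain ⟨r, hr⟩ : ∃ r, ⌈(w : ℚ) / (4 * (k : ℚ) ^ 4)⌉₊ = r + 1 :=
    ⟨_, (Nat.succ_pred (by omega)).symm⟩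
  -- Used at n = 1 and n = r: these are the two size conditions of the greedy construction, which
  -- yields r + 1 sequences.
  have hbound : ∀ n, n < ⌈(w : ℚ) / (4 * (k : ℚ) ^ 4)⌉₊ → 4 * k ^ 4 * n < w := by
    intro n hn
    rw [Nat.lt_ceil, lt_div_iff₀ hk0] at hn
    have : ((4 * k ^ 4 * n : ℕ) : ℚ) < w := by push_cast; linarith
    exact_mod_cast this
  obtain ⟨g, hg⟩ := exists_isPrimitiveRoot (F := F) (n := 2 * w * k) (m := 1)
    (by rw [hq]; ring) (by have := hwodd.pos; positivity)
  have hg0 : g ≠ 0 := hg.ne_zero (by have := hwodd.pos; positivity)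
  have hgk := hg.pow (by have := hwodd.pos; positivity) rfl
  have hinj : ∀ i < k, ∀ j < k, (g ^ i) ^ (2 * w) = (g ^ j) ^ (2 * w) → i = j := by
    intro i hi j hj h
    rw [pow_right_comm, pow_right_comm g j] at h
    exact hgk.pow_inj hi hj h
  obtain ⟨b, hb⟩ := exists_ratioDisjoint_family (θ := fun i => g ^ i) hk hq
    (by simpa using hbound 1 hlt) (fun i => pow_ne_zero i hg0) r (hbound r (by omega))
  have hb : ∀ s : Fin (r + 1), IsNormalizedTransversal k w (fun i => g ^ i) b s (b s) := fun s =>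
    hb s (by omega)
  rw [hr]
  have := le_maxOrthogonalCycleSystems_of_ratioDisjoint hq hwodd (fun s : Fin (r + 1) => b s)
    (fun s => ⟨(hb s).simple, fun i hi j hj h => hinj i hi j hj (by
      rwa [(hb s).pow_eq i hi, (hb s).pow_eq j hj] at h)⟩) (fun s t hst => by
      refine ratioDisjoint_of_pow_eq hinj (hb s).pow_eq (hb t).pow_eq fun i hi j hj h => ?_
      rcases lt_or_gt_of_ne hst with hlt | hlt
      · exact (hb t).ratio s hlt i hi j hj (by
          rw [mul_comm (b t i), mul_comm (b t j)]; exact h.symm)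
      · exact (hb s).ratio t hlt i hi j hj h)
  simpa using this

end Greedy

theorem ceil_le_maxOrthogonalCycleSystems_of_isPrimePow (k w : ℕ) (hk : 3 ≤ k)
    (hodd : Odd (k * w)) (hq : IsPrimePow (2 * k * w + 1)) :
    ⌈(w : ℚ) / (4 * (k : ℚ) ^ 4)⌉₊ ≤ maxOrthogonalCycleSystems k (2 * k * w + 1) := by
  classical
  obtain ⟨p, n, hp, hn, hpn⟩ := hq
  have := Fact.mk hp.nat_prime
  have := Fintype.ofFinite (GaloisField p n)
  refine ceil_le_maxOrthogonalCycleSystems (F := GaloisField p n) hk hodd ?_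
  rw [← Nat.card_eq_fintype_card, GaloisField.card p n hn.ne', hpn]

/-! ### Families of transversals with pairwise distinct ratios. -/

section DifferenceFamilies

variable {F : Type*} [Field F] [Fintype F] {k w : ℕ}

/-- If all ratios of entries of the transversals `a u` are distinct up to sign, then the multiples
of these transversals by suitable powers of `g` generate orthogonal cycle systems. -/
theorem card_mul_le_maxOrthogonalCycleSystems (hq : Fintype.card F = 2 * k * w + 1) (hw : Odd w)
    {g : F} (hg0 : g ≠ 0) (hg : ∀ s < k, ∀ t < k, (g ^ s) ^ (2 * w) = (g ^ t) ^ (2 * w) → s = t)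
    {m : ℕ} (a : ℕ → ℕ → F) (ha : ∀ u < m, IsTransversal k w (a u))
    (hratio : ∀ u < m, ∀ v < m, ∀ i < k, ∀ j < k, ∀ i' < k, ∀ j' < k, i ≠ j →
      (a u i * a v j') ^ 2 = (a u j * a v i') ^ 2 → u = v ∧ i = i') :
    m * k ≤ maxOrthogonalCycleSystems k (2 * k * w + 1) := by
  have := le_maxOrthogonalCycleSystems_of_ratioDisjoint (k := k) hq hw
    (fun (x : Fin m × Fin k) i => g ^ (x.2 : ℕ) * a x.1 i)
    (fun x => ⟨(ha x.1 x.1.2).simple.mul (pow_ne_zero _ hg0), fun i hi j hj h => by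
      rw [mul_pow, mul_pow] at h
      exact (ha x.1 x.1.2).pow_injOn i hi j hj
        (mul_left_cancel₀ (pow_ne_zero _ (pow_ne_zero _ hg0)) h)⟩)
    (fun x y hxy i hi j hj i' hi' j' hj' hii hjj hsq => by
      by_contra hne
      have hg2 : (g ^ (x.2 : ℕ) * g ^ (y.2 : ℕ)) ^ 2 ≠ 0 :=
        pow_ne_zero _ (mul_ne_zero (pow_ne_zero _ hg0) (pow_ne_zero _ hg0))
      -- A repeated ratio forces the same transversal and position; equality of cosets then forces
      -- the same power of g.
      obtain ⟨huv, rfl⟩ := hratio x.1 x.1.2 y.1 y.1.2 i hi j hj i' hi' j' hj' hne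
        (mul_left_cancel₀ hg2 (by linear_combination hsq))
      rw [← huv, mul_pow, mul_pow] at hii
      have := hg x.2 x.2.2 y.2 y.2.2 (mul_right_cancel₀
        (pow_ne_zero _ ((ha x.1 x.1.2).simple.ne_zero hi)) hii)
      exact hxy (Prod.ext (Fin.ext huv) (Fin.ext this)))
  simpa using this

end DifferenceFamilies

/-! ### Reduction to finite checks on residues modulo a prime. -/

section PrimeFields

/-- The `i`-th entry of the `u`-th list of `L`. -/
def entry (L : List (List ℕ)) (u i : ℕ) : ℕ := (L.getD u []).getD i 0

variable {p k w : ℕ}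

theorem partialSum_getD (l : List ℕ) (n : ℕ) :
    partialSum (fun i => ((l.getD i 0 : ℕ) : ZMod p)) n = ((l.take n).sum : ℕ) := by
  induction n with
  | zero => simp [partialSum]
  | succ n ih =>
    rw [partialSum_succ, ih]
    rcases Nat.lt_or_ge n l.length with h | h
    · rw [List.sum_take_succ l n h, List.getD_eq_getElem _ _ h]
      push_cast
      rfl
    · rw [List.take_of_length_le h, List.take_of_length_le (by omega),
        List.getD_eq_default _ _ h]
      simp

theorem isTransversal_getD (hk : 3 ≤ k) (l : List ℕ)
    (h0 : (l.take k).sum % p = 0)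
    (hsum : ∀ i < k, ∀ j < k, (l.take i).sum % p = (l.take j).sum % p → i = j)
    (hpow : ∀ i < k, ∀ j < k, l.getD i 0 ^ (2 * w) % p = l.getD j 0 ^ (2 * w) % p → i = j)
    [Fact p.Prime] :
    IsTransversal k w fun i => ((l.getD i 0 : ℕ) : ZMod p) := by
  refine ⟨⟨hk, ?_, fun i hi j hj h => hsum i hi j hj ?_⟩, fun i hi j hj h => hpow i hi j hj ?_⟩
  · rw [partialSum_getD]
    exact (ZMod.natCast_eq_zero_iff _ _).2 (Nat.dvd_of_mod_eq_zero h0)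
  · rw [partialSum_getD, partialSum_getD] at h
    exact (ZMod.natCast_eq_natCast_iff' _ _ _).1 h
  · exact (ZMod.natCast_eq_natCast_iff' _ _ _).1 (by exact_mod_cast h)

theorem mul_le_maxOrthogonalCycleSystems_of_lists [Fact p.Prime] (hp : p = 2 * k * w + 1)
    (hk : 3 ≤ k) (hw : Odd w) (g m : ℕ) (hg0 : g % p ≠ 0)
    (hg : ∀ s < k, ∀ t < k, (g ^ s) ^ (2 * w) % p = (g ^ t) ^ (2 * w) % p → s = t)
    (L : List (List ℕ)) (h0 : ∀ u < m, ((L.getD u []).take k).sum % p = 0)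
    (hsum : ∀ u < m, ∀ i < k, ∀ j < k,
      ((L.getD u []).take i).sum % p = ((L.getD u []).take j).sum % p → i = j)
    (hpow : ∀ u < m, ∀ i < k, ∀ j < k,
      entry L u i ^ (2 * w) % p = entry L u j ^ (2 * w) % p → i = j)
    (hratio : ∀ u < m, ∀ v < m, ∀ i < k, ∀ j < k, ∀ i' < k, ∀ j' < k, i ≠ j →
      (entry L u i * entry L v j') ^ 2 % p = (entry L u j * entry L v i') ^ 2 % p →
      u = v ∧ i = i') :
    m * k ≤ maxOrthogonalCycleSystems k p := by
  have hq : Fintype.card (ZMod p) = 2 * k * w + 1 := by rw [ZMod.card, hp]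
  have := card_mul_le_maxOrthogonalCycleSystems hq hw (g := (g : ZMod p))
    (fun h => hg0 (Nat.mod_eq_zero_of_dvd ((ZMod.natCast_eq_zero_iff _ _).1 h)))
    (fun s hs t ht h => hg s hs t ht
      ((ZMod.natCast_eq_natCast_iff' _ _ _).1 (by exact_mod_cast h)))
    (m := m) (fun u i => ((entry L u i : ℕ) : ZMod p))
    (fun u hu => isTransversal_getD hk _ (h0 u hu) (hsum u hu) (hpow u hu))
    (fun u hu v hv i hi j hj i' hi' j' hj' hij h => hratio u hu v hv i hi j hj i' hi' j' hj' hij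
      ((ZMod.natCast_eq_natCast_iff' _ _ _).1 (by exact_mod_cast h)))
  rwa [← hp] at this

theorem succ_le_maxOrthogonalCycleSystems_of_lists [Fact p.Prime] (hp : p = 2 * k * k + 1)
    (hk : 3 ≤ k) (hodd : Odd k) (m : ℕ)
    (L : List (List ℕ)) (h0 : ∀ u < m, ((L.getD u []).take k).sum % p = 0)
    (hsum : ∀ u < m, ∀ i < k, ∀ j < k,
      ((L.getD u []).take i).sum % p = ((L.getD u []).take j).sum % p → i = j)
    (hpow : ∀ i < k, ∀ j < k,
      entry L 0 i ^ (2 * k) % p = entry L 0 j ^ (2 * k) % p → i = j)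
    (hclass : ∀ u < m, ∀ i < k, entry L u i ^ (2 * k) % p = entry L 0 i ^ (2 * k) % p)
    (hratio : ∀ u < m, ∀ v < m, u ≠ v → ∀ i < k, ∀ j < k,
      (entry L u i * entry L v j) ^ 2 % p = (entry L u j * entry L v i) ^ 2 % p → i = j) :
    m + 1 ≤ maxOrthogonalCycleSystems k p := by
  have hq : Fintype.card (ZMod p) = 2 * k * k + 1 := by rw [ZMod.card, hp]
  have hclass' : ∀ u < m, ∀ i < k, ((entry L u i : ℕ) : ZMod p) ^ (2 * k) =
      ((entry L 0 i : ℕ) : ZMod p) ^ (2 * k) := fun u hu i hi => by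
    exact_mod_cast (ZMod.natCast_eq_natCast_iff' _ _ _).2 (hclass u hu i hi)
  have := succ_le_maxOrthogonalCycleSystems_of_ratioDisjoint hq hk hodd
    (fun (u : Fin m) i => ((entry L u i : ℕ) : ZMod p))
    (fun u => isTransversal_getD hk _ (h0 u u.2) (hsum u u.2) fun i hi j hj h =>
      hpow i hi j hj (by rwa [← hclass u u.2 i hi, ← hclass u u.2 j hj]))
    (fun u v huv => ratioDisjoint_of_pow_eq (θ := fun i => ((entry L 0 i : ℕ) : ZMod p))
      (fun i hi j hj h => hpow i hi j hj
        ((ZMod.natCast_eq_natCast_iff' _ _ _).1 (by exact_mod_cast h)))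
      (hclass' u u.2) (hclass' v v.2) (fun i hi j hj h =>
        hratio u u.2 v v.2 (fun h => huv (Fin.ext h)) i hi j hj
          ((ZMod.natCast_eq_natCast_iff' _ _ _).1 (by exact_mod_cast h))))
  rwa [← hp, Fintype.card_fin] at this

end PrimeFields

/-! ### Explicit transversals over prime fields. -/

set_option synthInstance.maxSize 2000 in
theorem five_le_maxOrthogonalCycleSystems_71 : 5 ≤ maxOrthogonalCycleSystems 5 71 := by
  have : Fact (Nat.Prime 71) := ⟨by norm_num⟩
  -- Here g = 7, whose first five powers lie in distinct cosets of the 14th roots of unity, and one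
  -- list is used.
  exact mul_le_maxOrthogonalCycleSystems_of_lists (p := 71) (k := 5) (w := 7) rfl
    (by decide) (by decide) 7 1
    (by decide) (by decide +kernel) [[7, 17, 4, 44, 70]]
    (by decide +kernel) (by decide +kernel) (by decide +kernel) (by decide +kernel)

set_option synthInstance.maxSize 2000 in
theorem seven_le_maxOrthogonalCycleSystems_211 : 7 ≤ maxOrthogonalCycleSystems 7 211 := by
  have : Fact (Nat.Prime 211) := ⟨by norm_num⟩
  exact mul_le_maxOrthogonalCycleSystems_of_lists (p := 211) (k := 7) (w := 15) rfl
    (by decide) (by decide) 2 1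
    (by decide) (by decide +kernel) [[48, 198, 84, 59, 70, 173, 1]]
    (by decide +kernel) (by decide +kernel) (by decide +kernel) (by decide +kernel)

set_option synthInstance.maxSize 2000 in
theorem eleven_le_maxOrthogonalCycleSystems_419 : 11 ≤ maxOrthogonalCycleSystems 11 419 := by
  have : Fact (Nat.Prime 419) := ⟨by norm_num⟩
  exact mul_le_maxOrthogonalCycleSystems_of_lists (p := 419) (k := 11) (w := 19) rfl
    (by decide) (by decide) 2 1
    (by decide) (by decide +kernel) [[162, 71, 223, 290, 301, 256, 120, 374, 109, 418, 190]]
    (by decide +kernel) (by decide +kernel) (by decide +kernel) (by decide +kernel)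

set_option synthInstance.maxSize 2000 in
theorem thirteen_le_maxOrthogonalCycleSystems_599 : 13 ≤ maxOrthogonalCycleSystems 13 599 := by
  have : Fact (Nat.Prime 599) := ⟨by norm_num⟩
  exact mul_le_maxOrthogonalCycleSystems_of_lists (p := 599) (k := 13) (w := 23) rfl
    (by decide) (by decide) 7 1
    (by decide) (by decide +kernel) [[148, 42, 400, 107, 387, 83, 353, 1, 35, 138, 406, 4, 292]]
    (by decide +kernel) (by decide +kernel) (by decide +kernel) (by decide +kernel)

set_option synthInstance.maxSize 2000 in
theorem ten_le_maxOrthogonalCycleSystems_151 : 10 ≤ maxOrthogonalCycleSystems 5 151 := by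
  have : Fact (Nat.Prime 151) := ⟨by norm_num⟩
  exact mul_le_maxOrthogonalCycleSystems_of_lists (p := 151) (k := 5) (w := 15) rfl
    (by decide) (by decide) 6 2
    (by decide) (by decide +kernel) [[1, 137, 139, 86, 90], [134, 51, 125, 142, 1]]
    (by decide +kernel) (by decide +kernel) (by decide +kernel) (by decide +kernel)

set_option synthInstance.maxSize 2000 in
theorem four_le_maxOrthogonalCycleSystems_163 : 4 ≤ maxOrthogonalCycleSystems 9 163 := by
  have : Fact (Nat.Prime 163) := ⟨by norm_num⟩
  exact succ_le_maxOrthogonalCycleSystems_of_lists (p := 163) (k := 9) rfl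
    (by decide) (by decide) 3
    [[100, 5, 62, 16, 146, 104, 70, 106, 43], [79, 64, 91, 9, 6, 104, 29, 156, 114],
      [112, 61, 10, 107, 65, 59, 144, 2, 92]]
    (by decide +kernel) (by decide +kernel) (by decide +kernel) (by decide +kernel)
    (by decide +kernel)

set_option synthInstance.maxSize 2000 in
theorem four_le_maxOrthogonalCycleSystems_883 : 4 ≤ maxOrthogonalCycleSystems 21 883 := by
  have : Fact (Nat.Prime 883) := ⟨by norm_num⟩
  exact succ_le_maxOrthogonalCycleSystems_of_lists (p := 883) (k := 21) rfl
    (by decide) (by decide) 3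
    [[429, 770, 362, 667, 594, 609, 120, 711, 329, 823, 205, 816, 328, 535, 791, 157, 448, 560,
      465, 305, 572],
      [449, 81, 223, 290, 861, 606, 705, 172, 56, 389, 237, 442, 330, 505, 742, 684, 459, 675,
      383, 408, 133],
      [437, 355, 52, 373, 130, 864, 58, 711, 385, 230, 218, 313, 472, 716, 648, 732, 734, 503,
      108, 595, 196]]
    (by decide +kernel) (by decide +kernel) (by decide +kernel) (by decide +kernel)
    (by decide +kernel)

set_option synthInstance.maxSize 2000 in
theorem four_le_maxOrthogonalCycleSystems_1459 : 4 ≤ maxOrthogonalCycleSystems 27 1459 := by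
  have : Fact (Nat.Prime 1459) := ⟨by norm_num⟩
  exact succ_le_maxOrthogonalCycleSystems_of_lists (p := 1459) (k := 27) rfl
    (by decide) (by decide) 3
    [[828, 1205, 637, 1114, 1149, 125, 842, 807, 784, 763, 1297, 487, 407, 1382, 119, 506, 227,
      1364, 1298, 1409, 523, 1006, 1092, 751, 991, 375, 397],
      [482, 134, 649, 970, 381, 112, 608, 318, 584, 870, 162, 713, 278, 1415, 128, 802, 1373, 299,
      714, 469, 1190, 1038, 1061, 1150, 1168, 1436, 463],
      [826, 228, 74, 1248, 233, 670, 715, 1286, 703, 358, 1297, 226, 681, 1017, 1094, 360, 1375,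
      349, 185, 824, 289, 475, 694, 920, 209, 411, 761]]
    (by decide +kernel) (by decide +kernel) (by decide +kernel) (by decide +kernel)
    (by decide +kernel)

/-! ### The field with 243 elements. -/

section OrderTwoHundredFortyThree

/-- Coefficient vectors of polynomials of degree less than five over the field with three
elements. -/
abbrev QuinticCoeff : Type := ZMod 3 × ZMod 3 × ZMod 3 × ZMod 3 × ZMod 3

/-- The coefficients of the residue of `X ^ n` modulo `X ^ 5 - X + 1`. -/
def quinticPow : ℕ → QuinticCoeff
  | 0 => (1, 0, 0, 0, 0)
  | n + 1 =>
    let v := quinticPow n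
    (-v.2.2.2.2, v.1 + v.2.2.2.2, v.2.1, v.2.2.1, v.2.2.2.1)

variable {R : Type*} [CommRing R] [Algebra (ZMod 3) R]

/-- Evaluation of the polynomial with given coefficients at `r`. -/
def quinticEval (r : R) : QuinticCoeff →+ R where
  toFun v := v.1 • (1 : R) + v.2.1 • r + v.2.2.1 • r ^ 2 + v.2.2.2.1 • r ^ 3 + v.2.2.2.2 • r ^ 4
  map_zero' := by simp
  map_add' u v := by simp only [Prod.fst_add, Prod.snd_add, add_smul]; ring

theorem quinticEval_quinticPow {r : R} (hr : r ^ 5 = r - 1) (n : ℕ) :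
    quinticEval r (quinticPow n) = r ^ n := by
  induction n with
  | zero => simp [quinticEval, quinticPow]
  | succ n ih =>
    rw [pow_succ, ← ih]
    simp only [quinticEval, quinticPow, AddMonoidHom.coe_mk, ZeroHom.coe_mk, Algebra.smul_def,
      map_neg, map_add]
    linear_combination -(algebraMap (ZMod 3) R (quinticPow n).2.2.2.2) * hr

theorem three_eq_zero : (3 : R) = 0 := by
  calc (3 : R) = algebraMap (ZMod 3) R 3 := (map_ofNat _ 3).symm
    _ = algebraMap (ZMod 3) R 0 := congrArg _ rfl
    _ = 0 := map_zero _

variable {F : Type*} [Field F] [Algebra (ZMod 3) F]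

theorem pow_eq_neg_one_of_pow_five {b : F} (hb : b ^ 5 = b - 1) : b ^ 121 = -1 := by
  rw [← quinticEval_quinticPow hb, show quinticPow 121 = (-1, 0, 0, 0, 0) by decide +kernel]
  simp [quinticEval]

/-- As 242 = 2 · 11², only the exponents 121 and 22 have to be ruled out. -/
theorem isPrimitiveRoot_of_pow_five {b : F} (hb : b ^ 5 = b - 1) : IsPrimitiveRoot b 242 := by
  have h3 : (3 : F) = 0 := three_eq_zero
  have h121 := pow_eq_neg_one_of_pow_five hb
  have h2 : (-1 : F) ≠ 1 := by
    intro h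
    exact one_ne_zero (α := F) (by linear_combination h3 + h)
  have h22 : b ^ 22 ≠ 1 := by
    intro h
    have h11 : b ^ 11 = -1 := by
      rw [← h121, show 121 = 22 * 5 + 11 by norm_num, pow_add b (22 * 5), pow_mul, h, one_pow,
        one_mul]
    -- In characteristic 3, b^11 = b(b - 1)² = b³ + b² + b, so b^11 + 1 factors; neither factor is
    -- compatible with b^5 = b - 1.
    have hfac : (b + 1) * (b ^ 2 + 1) = 0 := by
      linear_combination h11 - (b ^ 6 + b * (b - 1)) * hb + b ^ 2 * h3
    rcases mul_eq_zero.1 hfac with h | h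
    · obtain rfl := eq_neg_of_add_eq_zero_left h
      exact one_ne_zero (α := F) (by linear_combination hb)
    · refine one_ne_zero (α := F) ?_
      linear_combination hb - (b ^ 3 - b) * h
  rw [IsPrimitiveRoot.iff_orderOf]
  refine orderOf_eq_of_pow_and_pow_div_prime (by norm_num) ?_ ?_
  · rw [show 242 = 121 * 2 by norm_num, pow_mul, h121]
    norm_num
  · intro p hp hdvd
    have hp' : p = 2 ∨ p = 11 := by
      rw [show 242 = 2 * 11 ^ 2 by norm_num, hp.dvd_mul] at hdvd
      rcases hdvd with h | h
      · exact Or.inl ((Nat.prime_dvd_prime_iff_eq hp Nat.prime_two).1 h)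
      · exact Or.inr ((Nat.prime_dvd_prime_iff_eq hp (by norm_num)).1 (hp.dvd_of_dvd_pow h))
    rcases hp' with rfl | rfl
    · simpa [h121] using h2
    · simpa using h22

variable [Fintype F]

open Polynomial in
-- A computation modulo f = X^5 - X + 1 shows that f divides X^243 - X, which splits over `F`.
-- Irreducibility of f is not needed.
theorem exists_pow_five_eq_sub_one (hF : Fintype.card F = 243) : ∃ b : F, b ^ 5 = b - 1 := by
  set f : F[X] := X ^ 5 - X + 1 with hf
  have hdeg : f.natDegree = 5 := by rw [hf]; compute_degree!
  have hroot : (AdjoinRoot.root f) ^ 5 = AdjoinRoot.root f - 1 := by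
    have : AdjoinRoot.mk f (X ^ 5 - X + 1) = 0 := AdjoinRoot.mk_self
    simp only [map_add, map_sub, map_pow, AdjoinRoot.mk_X, map_one] at this
    linear_combination this
  have hpow : (AdjoinRoot.root f) ^ 243 = AdjoinRoot.root f := by
    conv_rhs => rw [← pow_one (AdjoinRoot.root f)]
    rw [← quinticEval_quinticPow hroot, ← quinticEval_quinticPow hroot]
    exact congrArg _ (by decide +kernel)
  have hdvd : f ∣ X ^ Fintype.card F - X := by
    rw [← AdjoinRoot.mk_eq_zero, map_sub, map_pow, AdjoinRoot.mk_X, hF, hpow, sub_self]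
  have hsplit : (X ^ Fintype.card F - X : F[X]).Splits := by
    have h := FiniteField.splits_X_pow_card_sub_X (K := F) 3
    rwa [Polynomial.map_sub, Polynomial.map_pow, Polynomial.map_X] at h
  have hne : (X ^ Fintype.card F - X : F[X]) ≠ 0 :=
    FiniteField.X_pow_card_sub_X_ne_zero F Fintype.one_lt_card
  obtain ⟨b, hb⟩ := (hsplit.of_dvd hne hdvd).exists_eval_eq_zero (by
    intro h
    rw [degree_eq_natDegree (ne_zero_of_dvd_ne_zero hne hdvd), hdeg] at h
    norm_num at h)
  refine ⟨b, ?_⟩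
  simp only [hf, eval_add, eval_sub, eval_pow, eval_X, eval_one] at hb
  linear_combination hb

/-- The powers of b exhaust the nonzero elements, so evaluation is onto, and both sides have 3^5
elements. Additive conditions can thus be checked on coefficient vectors. -/
theorem quinticEval_injective (hF : Fintype.card F = 243) {b : F} (hb : b ^ 5 = b - 1) :
    Function.Injective (quinticEval b) := by
  have hsurj : Function.Surjective (quinticEval b) := by
    intro x
    by_cases hx : x = 0
    · exact ⟨0, by rw [hx, map_zero]⟩
    · have h := FiniteField.pow_card_sub_one_eq_one x hx
      rw [hF] at h
      obtain ⟨i, -, hi⟩ := (isPrimitiveRoot_of_pow_five hb).eq_pow_of_pow_eq_one h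
      exact ⟨_, (quinticEval_quinticPow hb i).trans hi⟩
  refine ((Fintype.bijective_iff_surjective_and_card _).2 ⟨hsurj, ?_⟩).1
  rw [hF]
  simp [ZMod.card]

theorem IsSimpleZeroSum.map {G H : Type*} [AddCommGroup G] [AddCommGroup H] {k : ℕ} {a : ℕ → G}
    (ha : IsSimpleZeroSum k a) (f : G →+ H) (hf : Function.Injective f) :
    IsSimpleZeroSum k fun i => f (a i) := by
  have h : ∀ n, partialSum (fun i => f (a i)) n = f (partialSum a n) := fun n =>
    (map_sum f a _).symm
  refine ⟨ha.three_le, by rw [h, ha.sum_eq_zero, map_zero], fun i hi j hj hij => ?_⟩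
  rw [h, h] at hij
  exact ha.injOn i hi j hj (hf hij)

/-- Exponents of the entries of eight transversals in the field with `243` elements. -/
def quinticExponents : List (List ℕ) :=
  [[192, 204, 42, 87, 91, 140, 51, 110, 158, 134, 34],
    [236, 94, 31, 164, 146, 41, 84, 88, 158, 222, 221],
    [38, 226, 20, 241, 201, 63, 238, 66, 37, 189, 45],
    [203, 116, 130, 197, 14, 85, 150, 165, 37, 35, 232],
    [5, 127, 119, 153, 69, 107, 62, 143, 158, 2, 56],
    [170, 138, 229, 230, 124, 8, 95, 121, 158, 90, 1],
    [214, 28, 97, 186, 58, 151, 128, 99, 158, 57, 188],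
    [16, 160, 86, 142, 234, 52, 161, 77, 37, 145, 12]]

set_option synthInstance.maxSize 1000 in
theorem isSimpleZeroSum_quinticPow : ∀ u < 8,
    IsSimpleZeroSum 11 fun i => quinticPow (entry quinticExponents u i) := by
  have h0 : ∀ u < 8, partialSum (fun i => quinticPow (entry quinticExponents u i)) 11 = 0 := by
    unfold partialSum
    decide +kernel
  have h1 : ∀ u < 8, ∀ i < 11, ∀ j < 11,
      partialSum (fun i => quinticPow (entry quinticExponents u i)) i =
        partialSum (fun i => quinticPow (entry quinticExponents u i)) j → i = j := by
    unfold partialSum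
    decide +kernel
  exact fun u hu => ⟨by decide, h0 u hu, h1 u hu⟩

set_option synthInstance.maxSize 1000 in
theorem nine_le_maxOrthogonalCycleSystems_243 : 9 ≤ maxOrthogonalCycleSystems 11 243 := by
  have := Fact.mk Nat.prime_three
  have := Fintype.ofFinite (GaloisField 3 5)
  have hF : Fintype.card (GaloisField 3 5) = 243 := by
    rw [← Nat.card_eq_fintype_card, GaloisField.card 3 5 (by norm_num)]
    norm_num
  obtain ⟨b, hb⟩ := exists_pow_five_eq_sub_one hF
  have hprim := isPrimitiveRoot_of_pow_five hb
  have hmod : ∀ n : ℕ, b ^ (n % 242) = b ^ n := fun n => by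
    rw [hprim.eq_orderOf, pow_mod_orderOf]
  have hpow : ∀ m n : ℕ, b ^ m = b ^ n ↔ m % 242 = n % 242 := fun m n =>
    ⟨fun h => hprim.pow_inj (Nat.mod_lt _ (by norm_num)) (Nat.mod_lt _ (by norm_num))
      (by rw [hmod, hmod, h]), fun h => by rw [← hmod m, ← hmod n, h]⟩
  -- Multiplicative conditions become congruences of exponents modulo 242; the coset of b^e is given
  -- by e modulo 11.
  have hclass : ∀ u < 8, ∀ i < 11, (b ^ entry quinticExponents u i) ^ (2 * 11) =
      (b ^ entry quinticExponents 0 i) ^ (2 * 11) := by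
    simp only [← pow_mul, hpow]
    decide +kernel
  have hinj : ∀ i < 11, ∀ j < 11, (b ^ entry quinticExponents 0 i) ^ (2 * 11) =
      (b ^ entry quinticExponents 0 j) ^ (2 * 11) → i = j := by
    simp only [← pow_mul, hpow]
    decide +kernel
  have hratio : ∀ u < 8, ∀ v < 8, u ≠ v → ∀ i < 11, ∀ j < 11,
      (b ^ entry quinticExponents u i * b ^ entry quinticExponents v j) ^ 2 =
        (b ^ entry quinticExponents u j * b ^ entry quinticExponents v i) ^ 2 → i = j := by
    simp only [← pow_mul, ← pow_add, hpow]
    decide +kernel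
  have := succ_le_maxOrthogonalCycleSystems_of_ratioDisjoint (k := 11) hF (by decide) (by decide)
    (fun (u : Fin 8) i => b ^ entry quinticExponents u i)
    (fun u => ⟨by
      simpa only [quinticEval_quinticPow hb] using
        (isSimpleZeroSum_quinticPow u u.2).map _ (quinticEval_injective hF hb),
      fun i hi j hj h => hinj i hi j hj (by rwa [hclass u u.2 i hi, hclass u u.2 j hj] at h)⟩)
    (fun u v huv => ratioDisjoint_of_pow_eq (θ := fun i => b ^ entry quinticExponents 0 i) hinj
      (hclass u u.2) (hclass v v.2) (hratio u u.2 v v.2 fun h => huv (Fin.ext h)))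
  simpa using this

end OrderTwoHundredFortyThree

theorem mainTheorem1 :
    -- (i)
    (5 ≤ maxOrthogonalCycleSystems 5 71 ∧
      7 ≤ maxOrthogonalCycleSystems 7 211 ∧
      11 ≤ maxOrthogonalCycleSystems 11 419 ∧
      13 ≤ maxOrthogonalCycleSystems 13 599) ∧
    -- (ii)
    10 ≤ maxOrthogonalCycleSystems 5 151 ∧
    -- (iii)
    (∀ n ∈ ({3, 7, 9} : Set ℕ), 4 ≤ maxOrthogonalCycleSystems (3 * n) (18 * n ^ 2 + 1)) ∧
    -- (iv)
    9 ≤ maxOrthogonalCycleSystems 11 243 ∧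
    -- (v)
    (∀ k w : ℕ, 3 ≤ k → Odd (k * w) → IsPrimePow (2 * k * w + 1) →
      ⌈(w : ℚ) / (4 * (k : ℚ) ^ 4)⌉₊ ≤ maxOrthogonalCycleSystems k (2 * k * w + 1)) := by
  refine ⟨⟨five_le_maxOrthogonalCycleSystems_71, seven_le_maxOrthogonalCycleSystems_211,
    eleven_le_maxOrthogonalCycleSystems_419, thirteen_le_maxOrthogonalCycleSystems_599⟩,
    ten_le_maxOrthogonalCycleSystems_151, ?_, nine_le_maxOrthogonalCycleSystems_243,
    ceil_le_maxOrthogonalCycleSystems_of_isPrimePow⟩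
  -- With k = 3n the order 18n² + 1 is 2k² + 1, the case w = k.
  rintro n (rfl | rfl | rfl)
  · exact four_le_maxOrthogonalCycleSystems_163
  · exact four_le_maxOrthogonalCycleSystems_883
  · exact four_le_maxOrthogonalCycleSystems_1459
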